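/- Let $H_2(p)=-p\log_2 p-(1-p)\log_2(1-p)$ be the binary entropy function, let $H_2^{-1}:[0,1]\to[0,1/2]$ be the inverse of its restriction to $[0,1/2]$, and let $$\kappa_Z(\delta)=\sup_{0<\kappa<1-H_2(\delta)}\kappa\left(1-\frac{\delta}{H_2^{-1}(1-\kappa)}\right)$$ be the rate given by the Zyablov bound (the supremum of the empty set, which occurs for $\delta=1/2$, is $0$). Consider inputs consisting of $n$ binary vectors $x_0,\dots,x_{n-1}\in\{0,1\}^m$, together with two numbers $d_{\min}<d_2$, such that there is a unique pair $\{x_a,x_b\}$ (with $a\neq b$ not known to the algorithm) at the minimum pairwise Hamming distance $d_{\min}$, and $d_2$ is the second minimum distance, that is, the minimum of the Hamming distances of all the other pairs. Put $\delta=d_{\min}/m$ and $\delta'=d_2/m$. Algorithms are programs for a random access machine with logarithmic cost and with fair coin tosses. (a) There is a randomized algorithm which, on every such input, finds the closest pair $\{a,b\}$ with probability at least $1-1/n^2$, and which always halts within time $$O\left(n\log^2 n\cdot 2^{\left(1-\kappa_Z(\delta')-\delta-(1-\delta)H_2\left(\frac{\delta'-\delta}{2(1-\delta)}\right)\right)m}\cdot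 \mathrm{poly}(m)\right).$$ (b) There is a randomized algorithm which, on every such input, and given black box access to a decoder of an arbitrary binary code $C\subseteq\{0,1\}^m$ with minimum distance at least $d=d_2+1$ that meets the Gilbert-Varshamov bound $\frac1m\log_2|C|\ge 1-H_2(d/m)$, finds the closest pair with probability at least $1-1/n^2$ and always halts within time $$O\left(n\log^2 n\cdot 2^{\left(H_2(\delta')-\delta-(1-\delta)H_2\left(\frac{\delta'-\delta}{2(1-\delta)}\right)\right)m}\cdot \mathrm{poly}(m)\right).$$ Here a decoder is a map $\{0,1\}^m\to\{0,1\}^m$ that sends every word within Hamming distance $\lfloor (d-1)/2\rfloor=\lfloor d_2/2\rfloor$ of a codeword to that codeword (its other values are arbitrary), and a call to it is charged only for transferring its $m$-bit argument and value. The implied constants and the polynomials are absolute: they do not depend on $n$, $m$, $d_{\min}$, $d_2$, the vectors, the code or the decoder. -/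

import Mathlib

/-! ### Entropy and the Zyablov bound -/

noncomputable section

/-- The binary entropy function `H₂(p) = -p log₂ p - (1-p) log₂ (1-p)`. -/
def H2 (p : ℝ) : ℝ := Real.binEntropy p / Real.log 2

/-- The inverse of `H₂` restricted to `[0, 1/2]`; on `[0, 1]` it is the genuine inverse. -/
def H2inv (y : ℝ) : ℝ := Function.invFunOn H2 (Set.Icc 0 (1 / 2)) y

/-- The rate given by the Zyablov bound at relative distance `δ`:
the supremum of `κ (1 - δ / H₂⁻¹(1 - κ))` over inner rates `0 < κ < 1 - H₂(δ)`.
It is a maximum for `0 < δ < 1/2`; for `1/2 ≤ δ ≤ 1` its value is `0`. -/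
def kappaZ (δ : ℝ) : ℝ :=
  sSup ((fun κ : ℝ => κ * (1 - δ / H2inv (1 - κ))) '' Set.Ioo 0 (1 - H2 δ))

end

/-! ### Binary vectors, codes, decoders -/

/-- The Hamming cube `{0,1}^m`. -/
abbrev Cube (m : ℕ) : Type := Fin m → Bool

/-- `C` is a binary code of block length `m` in which distinct codewords have distance at
least `d`. -/
def IsCode {m : ℕ} (C : Finset (Cube m)) (d : ℕ) : Prop :=
  ∀ v ∈ C, ∀ w ∈ C, v ≠ w → d ≤ hammingDist v w

/-- The rate `(log₂ |C|) / m`. -/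
noncomputable def codeRate {m : ℕ} (C : Finset (Cube m)) : ℝ :=
  Real.logb 2 (C.card : ℝ) / (m : ℝ)

/-- A nonempty code with designed distance `d` meets the Gilbert-Varshamov bound:
its rate is at least `1 - H₂(d/m)`. -/
def MeetsGV {m : ℕ} (C : Finset (Cube m)) (d : ℕ) : Prop :=
  C.Nonempty ∧ 1 - H2 ((d : ℝ) / (m : ℝ)) ≤ codeRate C

/-- `dec` is a unique decoder for `C` with radius `⌊(d-1)/2⌋`: every word within that distance
of a codeword is sent to this codeword.  On all other words the output of `dec` is arbitrary. -/
def IsUniqueDecoder {m : ℕ} (C : Finset (Cube m)) (d : ℕ) (dec : Cube m → Cube m) : Prop :=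
  ∀ v : Cube m, ∀ w ∈ C, hammingDist v w ≤ (d - 1) / 2 → dec v = w

/-! ### Instances of the Closest Pair Problem -/

/-- Among the `n` vectors `x`, the pair of positions `a < b` is the unique pair at minimum
distance `dmin`, and `d2 > dmin` is the second minimum distance, i.e. the least distance of
all the other pairs. -/
def IsGappedInstance {n m : ℕ} (x : Fin n → Cube m) (a b : Fin n) (dmin d2 : ℕ) : Prop :=
  a < b ∧ hammingDist (x a) (x b) = dmin ∧ dmin < d2 ∧
    IsLeast {d : ℕ | ∃ i j : Fin n, i < j ∧ (i, j) ≠ (a, b) ∧ hammingDist (x i) (x j) = d} d2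

/-! ### The machine model

A random access machine with logarithmic cost, programmed in a structured language.  The machine
has finitely many named registers (those that occur in the program) and an unbounded memory
of cells; both hold natural numbers.  Every operation is charged according to the bit lengths
(`Nat.size`) of the numbers and addresses that it handles.  There is an instruction that tosses a
fair coin, and one that calls a black box on a vector stored in memory. -/

namespace RAM

/-- Binary operations (subtraction is truncated; division and remainder are those of `ℕ`). -/
inductive Op
  | add | sub | mul | div | mod

def Op.eval : Op → ℕ → ℕ → ℕ
  | .add, u, v => u + v
  | .sub, u, v => u - v
  | .mul, u, v => u * v
  | .div, u, v => u / v
  | .mod, u, v => u % v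

/-- Linear cost for addition and subtraction, quadratic (schoolbook) cost for the others. -/
def Op.cost : Op → ℕ → ℕ → ℕ
  | .add, u, v => 1 + u.size + v.size
  | .sub, u, v => 1 + u.size + v.size
  | .mul, u, v => (1 + u.size) * (1 + v.size)
  | .div, u, v => (1 + u.size) * (1 + v.size)
  | .mod, u, v => (1 + u.size) * (1 + v.size)

/-- A state: the registers, the memory, and the number of coins tossed so far. -/
structure State where
  reg : ℕ → ℕ
  mem : ℕ → ℕ
  coins : ℕ

/-- Expressions: constants, registers, memory cells, binary operations. -/
inductive Expr
  | lit (k : ℕ)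
  | reg (r : ℕ)
  | load (addr : Expr)
  | bin (op : Op) (e f : Expr)

def Expr.eval (s : State) : Expr → ℕ
  | .lit k => k
  | .reg r => s.reg r
  | .load e => s.mem (e.eval s)
  | .bin op e f => op.eval (e.eval s) (f.eval s)

def Expr.cost (s : State) : Expr → ℕ
  | .lit k => 1 + k.size
  | .reg r => 1 + (s.reg r).size
  | .load e => e.cost s + 1 + (e.eval s).size + (s.mem (e.eval s)).size
  | .bin op e f => e.cost s + f.cost s + op.cost (e.eval s) (f.eval s)

/-- Programs.  A test `e` succeeds if the value of `e` is not `0`. -/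
inductive Cmd
  | skip
  | assign (r : ℕ) (e : Expr)
  | store (addr e : Expr)
  | flip (r : ℕ)
  | query (src dst : Expr)
  | seq (c c' : Cmd)
  | ite (e : Expr) (c c' : Cmd)
  | loop (e : Expr) (c : Cmd)

/-- The program does not call the black box. -/
def Cmd.OracleFree : Cmd → Prop
  | .skip => True
  | .assign _ _ => True
  | .store _ _ => True
  | .flip _ => True
  | .query _ _ => False
  | .seq c c' => c.OracleFree ∧ c'.OracleFree
  | .ite _ c c' => c.OracleFree ∧ c'.OracleFree
  | .loop _ c => c.OracleFree

/-- Set register `r` to `v`. -/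
def State.setReg (s : State) (r v : ℕ) : State :=
  { s with reg := Function.update s.reg r v }

/-- Set the memory cell with address `i` to `v`. -/
def State.setMem (s : State) (i v : ℕ) : State :=
  { s with mem := Function.update s.mem i v }

/-- The vector stored in the `m` cells from address `i` on (a nonzero cell is read as `1`). -/
def State.readVec (s : State) (m i : ℕ) : Cube m :=
  fun k => decide (s.mem (i + k) ≠ 0)

/-- Write the vector `v` into the `m` cells from address `i` on. -/
def State.writeVec {m : ℕ} (s : State) (i : ℕ) (v : Cube m) : State :=
  { s with mem := fun j =>
      if h : i ≤ j ∧ j - i < m then (v ⟨j - i, h.2⟩).toNat else s.mem j }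

/-- `Exec dec ω c s s' t`: started in state `s`, with black box `dec` and with coin
tosses `ω 0, ω 1, …`, the program `c` halts in state `s'` after time `t`. -/
inductive Exec {m : ℕ} (dec : Cube m → Cube m) (ω : ℕ → Bool) :
    Cmd → State → State → ℕ → Prop
  | skip (s : State) : Exec dec ω .skip s s 1
  | assign (r : ℕ) (e : Expr) (s : State) :
      Exec dec ω (.assign r e) s (s.setReg r (e.eval s)) (e.cost s + 1 + (e.eval s).size)
  | store (f e : Expr) (s : State) :
      Exec dec ω (.store f e) s (s.setMem (f.eval s) (e.eval s))
        (f.cost s + e.cost s + 1 + (f.eval s).size + (e.eval s).size)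
  | flip (r : ℕ) (s : State) :
      Exec dec ω (.flip r) s
        { s.setReg r (ω s.coins).toNat with coins := s.coins + 1 } 2
  | query (f g : Expr) (s : State) :
      Exec dec ω (.query f g) s
        (s.writeVec (g.eval s) (dec (s.readVec m (f.eval s))))
        (f.cost s + g.cost s + 1 + m * (f.eval s + m).size + m * (g.eval s + m).size)
  | seq (c c' : Cmd) (s s' s'' : State) (t t' : ℕ) :
      Exec dec ω c s s' t → Exec dec ω c' s' s'' t' →
      Exec dec ω (.seq c c') s s'' (t + t')
  | iteTrue (e : Expr) (c c' : Cmd) (s s' : State) (t : ℕ) :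
      e.eval s ≠ 0 → Exec dec ω c s s' t →
      Exec dec ω (.ite e c c') s s' (e.cost s + 1 + t)
  | iteFalse (e : Expr) (c c' : Cmd) (s s' : State) (t : ℕ) :
      e.eval s = 0 → Exec dec ω c' s s' t →
      Exec dec ω (.ite e c c') s s' (e.cost s + 1 + t)
  | loopDone (e : Expr) (c : Cmd) (s : State) :
      e.eval s = 0 → Exec dec ω (.loop e c) s s (e.cost s + 1)
  | loopStep (e : Expr) (c : Cmd) (s s' s'' : State) (t t' : ℕ) :
      e.eval s ≠ 0 → Exec dec ω c s s' t → Exec dec ω (.loop e c) s' s'' t' →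
      Exec dec ω (.loop e c) s s'' (e.cost s + 1 + t + t')

/-- The initial state: registers `0, 1, 2, 3` hold `n, m, dmin, d2`, the memory
cell `i * m + k` holds the `k`-th bit of the `i`-th vector, everything else is `0`. -/
def initState {n m : ℕ} (x : Fin n → Cube m) (dmin d2 : ℕ) : State where
  reg := fun r =>
    if r = 0 then n else if r = 1 then m else if r = 2 then dmin else if r = 3 then d2 else 0
  mem := fun j =>
    if h : j < n * m then
      (x (Fin.divNat (⟨j, h⟩ : Fin (n * m))) (Fin.modNat (⟨j, h⟩ : Fin (n * m)))).toNat
    else 0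
  coins := 0

/-- The output, in registers `0` and `1`, is the pair of positions `{a, b}`. -/
def Outputs (s : State) (a b : ℕ) : Prop :=
  (s.reg 0 = a ∧ s.reg 1 = b) ∨ (s.reg 0 = b ∧ s.reg 1 = a)

/-- The law of an infinite sequence of independent fair coin tosses. -/
noncomputable def coinLaw : MeasureTheory.Measure (ℕ → Bool) :=
  MeasureTheory.Measure.infinitePi fun _ : ℕ => (PMF.uniformOfFintype Bool).toMeasure

/-- On input `x, dmin, d2`, and with black box `dec`, the program `P` halts within time `T`
whatever the coin tosses are, and with probability at least `1 - 1/n²` it outputs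
the pair `{a, b}`. -/
def FindsPair {n m : ℕ} (dec : Cube m → Cube m) (P : Cmd) (x : Fin n → Cube m)
    (a b : Fin n) (dmin d2 : ℕ) (T : ℝ) : Prop :=
  (∀ ω : ℕ → Bool, ∃ (s : State) (t : ℕ),
    Exec dec ω P (initState x dmin d2) s t ∧ (t : ℝ) ≤ T) ∧
  1 - 1 / (n : ℝ) ^ 2 ≤
    coinLaw.real {ω : ℕ → Bool | ∃ (s : State) (t : ℕ),
      Exec dec ω P (initState x dmin d2) s t ∧ Outputs s a b}

end RAM

/-- `δ + (1-δ) H₂((δ'-δ) / (2(1-δ)))`. -/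
noncomputable def midExponent (δ δ' : ℝ) : ℝ :=
  δ + (1 - δ) * H2 ((δ' - δ) / (2 * (1 - δ)))

/-- `A · n (log₂ n)² · 2^{γ m} · m^k`. -/
noncomputable def timeBound (A k : ℕ) (γ : ℝ) (n m : ℕ) : ℝ :=
  (A : ℝ) * ((n : ℝ) * Real.logb 2 (n : ℝ) ^ 2 * (2 : ℝ) ^ (γ * (m : ℝ)) * (m : ℝ) ^ k)

/-!
One program, which never calls the decoder, serves both parts.  Each repetition draws a random set
`S` of `min m (2 * d2 - 1)` coordinates and compares only vectors that agree off `S`.  All vectors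
except `b` have pairwise distance at least `d2`, so by the Plotkin bound a class of this partition
has at most `2 * d2 + 1` members, and a repetition takes time `n * poly m`.  The closest pair is
found as soon as `S` contains the `dmin` coordinates in which `x a` and `x b` differ.  If
`2 * d2 ≤ m`, the inverse of the probability of this event is, with falling factorials and up to
polynomial factors, at most
`(m)_dmin / (2 ^ dmin * (d2)_dmin) = 2 ^ (-dmin) * m.choose d2 / (m - dmin).choose (d2 - dmin)`,
hence at most `2 ^ ((H2 δ' - midExponent δ δ') * m)` by the entropy estimates of binomial
coefficients; part (a) follows from `κ_Z ≤ 1 - H2`.  If `2 * d2 > m`, then `S` contains all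
coordinates, the first exponent is nonnegative because `κ_Z ≤ 0`, and a code that meets the
Gilbert-Varshamov bound has at most `2 * (m + 1)` words, so the second one costs a factor `poly m`.
-/

/-! ### Entropy and binomial coefficients -/

theorem choose_mul_pow_le_succ {N k i : ℕ} (hk : k ≤ N) (hi : i < k) :
    N.choose i * k ^ i * (N - k) ^ (N - i)
      ≤ N.choose (i + 1) * k ^ (i + 1) * (N - k) ^ (N - (i + 1)) := by
  have hchoose : N.choose (i + 1) * (i + 1) = N.choose i * (N - i) := Nat.choose_succ_right_eq N i
  have hratio : (i + 1) * (N - k) ≤ (N - i) * k := by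
    rw [mul_comm (N - i)]
    exact Nat.mul_le_mul hi (by omega)
  have hsub : N - i = N - (i + 1) + 1 := by omega
  refine Nat.le_of_mul_le_mul_left ?_ (Nat.add_one_pos i)
  calc (i + 1) * (N.choose i * k ^ i * (N - k) ^ (N - i))
      = (N.choose i * k ^ i * (N - k) ^ (N - (i + 1))) * ((i + 1) * (N - k)) := by
        conv_lhs => rw [hsub, pow_succ]
        ring
    _ ≤ (N.choose i * k ^ i * (N - k) ^ (N - (i + 1))) * ((N - i) * k) :=
        Nat.mul_le_mul_left _ hratio
    _ = (N.choose i * (N - i)) * (k ^ (i + 1) * (N - k) ^ (N - (i + 1))) := by ring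
    _ = _ := by rw [← hchoose]; ring

theorem choose_mul_pow_succ_le {N k i : ℕ} (hi : k ≤ i) (hN : i < N) :
    N.choose (i + 1) * k ^ (i + 1) * (N - k) ^ (N - (i + 1))
      ≤ N.choose i * k ^ i * (N - k) ^ (N - i) := by
  have hchoose : N.choose (i + 1) * (i + 1) = N.choose i * (N - i) := Nat.choose_succ_right_eq N i
  have hratio : (N - i) * k ≤ (i + 1) * (N - k) := by
    rw [mul_comm (N - i)]
    exact Nat.mul_le_mul (by omega) (by omega)
  have hsub : N - i = N - (i + 1) + 1 := by omega
  refine Nat.le_of_mul_le_mul_left ?_ (Nat.add_one_pos i)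
  calc (i + 1) * (N.choose (i + 1) * k ^ (i + 1) * (N - k) ^ (N - (i + 1)))
      = (N.choose (i + 1) * (i + 1)) * (k ^ (i + 1) * (N - k) ^ (N - (i + 1))) := by ring
    _ = (N.choose i * k ^ i * (N - k) ^ (N - (i + 1))) * ((N - i) * k) := by rw [hchoose]; ring
    _ ≤ (N.choose i * k ^ i * (N - k) ^ (N - (i + 1))) * ((i + 1) * (N - k)) :=
        Nat.mul_le_mul_left _ hratio
    _ = _ := by
        conv_rhs => rw [hsub, pow_succ]
        ring

theorem choose_mul_pow_le_mode {N k i : ℕ} (hk : k ≤ N) (hi : i ≤ N) :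
    N.choose i * k ^ i * (N - k) ^ (N - i) ≤ N.choose k * k ^ k * (N - k) ^ (N - k) := by
  rcases le_total i k with h | h
  · induction h using Nat.decreasingInduction with
    | self => exact le_rfl
    | of_succ j hj ih => exact (choose_mul_pow_le_succ hk hj).trans (ih (by omega))
  · induction i, h using Nat.le_induction with
    | base => exact le_rfl
    | succ j hj ih => exact (choose_mul_pow_succ_le hj (by omega)).trans (ih (by omega))

theorem pow_eq_sum_choose_mul_pow {N k : ℕ} (hk : k ≤ N) :
    N ^ N = ∑ i ∈ Finset.range (N + 1), N.choose i * k ^ i * (N - k) ^ (N - i) := by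
  conv_lhs => enter [1]; rw [← Nat.add_sub_cancel' hk]
  rw [add_pow]
  exact Finset.sum_congr rfl fun i _ => by push_cast; ring

theorem choose_mul_pow_le_pow {N k : ℕ} (hk : k ≤ N) :
    N.choose k * k ^ k * (N - k) ^ (N - k) ≤ N ^ N := by
  rw [pow_eq_sum_choose_mul_pow hk]
  exact Finset.single_le_sum (f := fun i => N.choose i * k ^ i * (N - k) ^ (N - i))
    (fun _ _ => Nat.zero_le _) (Finset.mem_range.2 (Nat.lt_succ_of_le hk))

theorem pow_le_choose_mul_pow {N k : ℕ} (hk : k ≤ N) :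
    N ^ N ≤ (N + 1) * (N.choose k * k ^ k * (N - k) ^ (N - k)) := by
  calc N ^ N = ∑ i ∈ Finset.range (N + 1), N.choose i * k ^ i * (N - k) ^ (N - i) :=
        pow_eq_sum_choose_mul_pow hk
    _ ≤ ∑ _i ∈ Finset.range (N + 1), N.choose k * k ^ k * (N - k) ^ (N - k) :=
        Finset.sum_le_sum fun i hi =>
          choose_mul_pow_le_mode hk (Nat.lt_succ_iff.1 (Finset.mem_range.1 hi))
    _ = _ := by rw [Finset.sum_const, Finset.card_range, smul_eq_mul]

theorem exp_mul_log_inv_div_mul_pow {b : ℝ} (hb : 0 < b) (a : ℕ) :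
    Real.exp (a * Real.log ((a : ℝ) / b)⁻¹) * (a : ℝ) ^ a = b ^ a := by
  rcases Nat.eq_zero_or_pos a with rfl | ha
  · simp
  have ha' : (0 : ℝ) < a := Nat.cast_pos.2 ha
  rw [Real.exp_nat_mul, Real.exp_log (by positivity), ← mul_pow, inv_div,
    div_mul_cancel₀ _ ha'.ne']

theorem two_rpow_H2_mul (p x : ℝ) : (2 : ℝ) ^ (H2 p * x) = Real.exp (x * Real.binEntropy p) := by
  have h : Real.log 2 ≠ 0 := (Real.log_pos one_lt_two).ne'
  rw [Real.rpow_def_of_pos two_pos, H2]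
  congr 1
  field_simp

theorem two_rpow_H2_mul_pow {N k : ℕ} (hk : k ≤ N) :
    (2 : ℝ) ^ (H2 ((k : ℝ) / N) * N) * ((k ^ k * (N - k) ^ (N - k) : ℕ) : ℝ) = (N : ℝ) ^ N := by
  rcases Nat.eq_zero_or_pos N with rfl | hN
  · obtain rfl : k = 0 := by omega
    simp
  have hN' : (0 : ℝ) < N := Nat.cast_pos.2 hN
  have hcompl : 1 - (k : ℝ) / N = ((N - k : ℕ) : ℝ) / N := by
    rw [Nat.cast_sub hk]
    field_simp
  have hentropy : (N : ℝ) * Real.binEntropy ((k : ℝ) / N) =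
      k * Real.log ((k : ℝ) / N)⁻¹ +
        ((N - k : ℕ) : ℝ) * Real.log (((N - k : ℕ) : ℝ) / N)⁻¹ := by
    rw [Real.binEntropy, hcompl]
    field_simp
  rw [two_rpow_H2_mul, hentropy, Real.exp_add]
  push_cast only [Nat.cast_mul, Nat.cast_pow]
  rw [mul_mul_mul_comm, exp_mul_log_inv_div_mul_pow hN', exp_mul_log_inv_div_mul_pow hN', ← pow_add,
    Nat.add_sub_cancel' hk]

theorem choose_le_two_rpow {N k : ℕ} (hk : k ≤ N) :
    (N.choose k : ℝ) ≤ 2 ^ (H2 ((k : ℝ) / N) * N) := by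
  have hpos : 0 < k ^ k * (N - k) ^ (N - k) := Nat.mul_pos Nat.pow_self_pos Nat.pow_self_pos
  refine le_of_mul_le_mul_right ?_ (Nat.cast_pos.2 hpos : (0 : ℝ) < _)
  rw [two_rpow_H2_mul_pow hk]
  have := choose_mul_pow_le_pow hk
  rw [mul_assoc] at this
  exact_mod_cast this

theorem two_rpow_le_choose {N k : ℕ} (hk : k ≤ N) :
    (2 : ℝ) ^ (H2 ((k : ℝ) / N) * N) ≤ (N + 1) * N.choose k := by
  have hpos : 0 < k ^ k * (N - k) ^ (N - k) := Nat.mul_pos Nat.pow_self_pos Nat.pow_self_pos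
  refine le_of_mul_le_mul_right ?_ (Nat.cast_pos.2 hpos : (0 : ℝ) < _)
  rw [two_rpow_H2_mul_pow hk]
  have := pow_le_choose_mul_pow hk
  rw [mul_assoc (N.choose k), ← mul_assoc (N + 1)] at this
  exact_mod_cast this

theorem H2_zero : H2 0 = 0 := by simp [H2]

theorem H2_one_half : H2 (1 / 2) = 1 := by
  rw [H2, one_div, Real.binEntropy_two_inv, div_self (Real.log_pos one_lt_two).ne']

theorem H2_le_one (p : ℝ) : H2 p ≤ 1 := by
  rw [H2, div_le_one (Real.log_pos one_lt_two)]
  exact Real.binEntropy_le_log_two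

theorem H2_nonneg {p : ℝ} (h0 : 0 ≤ p) (h1 : p ≤ 1) : 0 ≤ H2 p :=
  div_nonneg (Real.binEntropy_nonneg h0 h1) (Real.log_pos one_lt_two).le

theorem H2_monotoneOn : MonotoneOn H2 (Set.Icc 0 (1 / 2)) := by
  rw [one_div]
  exact fun p hp q hq hpq => div_le_div_of_nonneg_right
    (Real.binEntropy_strictMonoOn.monotoneOn hp hq hpq) (Real.log_pos one_lt_two).le

theorem H2_le_H2_of_one_half_le {p q : ℝ} (hp : 1 / 2 ≤ p) (hp1 : p ≤ 1) (hpq : p ≤ q) :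
    H2 q ≤ H2 p := by
  have hp' : 2⁻¹ ≤ p := by linarith
  refine div_le_div_of_nonneg_right ?_ (Real.log_pos one_lt_two).le
  rcases le_total q 1 with hq | hq
  · exact Real.binEntropy_strictAntiOn.antitoneOn ⟨hp', hp1⟩ ⟨hp'.trans hpq, hq⟩ hpq
  · exact (Real.binEntropy_nonpos_of_one_le hq).trans
      (Real.binEntropy_nonneg (by linarith) hp1)

theorem midExponent_le_one {δ : ℝ} (hδ : δ ≤ 1) (δ' : ℝ) : midExponent δ δ' ≤ 1 := by
  have := mul_le_mul_of_nonneg_left (H2_le_one ((δ' - δ) / (2 * (1 - δ)))) (sub_nonneg.2 hδ)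
  rw [midExponent]
  linarith

theorem midExponent_div_mul {m : ℝ} (hm : m ≠ 0) (d d' : ℝ) :
    midExponent (d / m) (d' / m) * m = d + H2 ((d' - d) / (m - d) / 2) * (m - d) := by
  have harg : (d' / m - d / m) / (2 * (1 - d / m)) = (d' - d) / (m - d) / 2 := by
    rw [← sub_div, one_sub_div hm, mul_div_assoc', div_div_div_cancel_right₀ hm, div_div, mul_comm]
  rw [midExponent, harg]
  field_simp

theorem two_rpow_midExponent_le {m d d' : ℕ} (h : d ≤ d') (hm : 2 * d' ≤ m) (hm0 : 0 < m) :
    (2 : ℝ) ^ (midExponent ((d : ℝ) / m) ((d' : ℝ) / m) * m) ≤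
      (m + 1) * (2 ^ d * (m - d).choose (d' - d)) := by
  have hM : ((m - d : ℕ) : ℝ) = m - d := Nat.cast_sub (by omega)
  have hD : ((d' - d : ℕ) : ℝ) = d' - d := Nat.cast_sub h
  have hM0 : (0 : ℝ) < (m - d : ℕ) := by
    have : 0 < m - d := by omega
    exact_mod_cast this
  have hhalf : ((d' - d : ℕ) : ℝ) / (m - d : ℕ) ≤ 1 / 2 := by
    rw [div_le_div_iff₀ hM0 two_pos]
    have : (d' - d) * 2 ≤ 1 * (m - d) := by omega
    exact_mod_cast this
  have hmono : H2 (((d' - d : ℕ) : ℝ) / (m - d : ℕ) / 2) ≤ H2 (((d' - d : ℕ) : ℝ) / (m - d : ℕ)) :=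
    H2_monotoneOn ⟨by positivity, by linarith⟩ ⟨by positivity, hhalf⟩ (half_le_self (by positivity))
  rw [midExponent_div_mul (by positivity), ← hM, ← hD, Real.rpow_add two_pos, Real.rpow_natCast]
  calc _ ≤ (2 : ℝ) ^ d * 2 ^ (H2 (((d' - d : ℕ) : ℝ) / (m - d : ℕ)) * (m - d : ℕ)) := by
        gcongr
        norm_num
    _ ≤ (2 : ℝ) ^ d * (((m - d : ℕ) + 1) * (m - d).choose (d' - d)) := by
        gcongr
        exact two_rpow_le_choose (by omega)
    _ ≤ (2 : ℝ) ^ d * ((m + 1) * (m - d).choose (d' - d)) := by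
        gcongr
        omega
    _ = _ := by ring

theorem choose_le_two_rpow_sub_midExponent {m d d' : ℕ} (h : d ≤ d') (hm : 2 * d' ≤ m)
    (hm0 : 0 < m) :
    (m.choose d : ℝ) ≤ (m + 1) * (2 ^ d * d'.choose d) *
      2 ^ ((H2 ((d' : ℝ) / m) - midExponent ((d : ℝ) / m) ((d' : ℝ) / m)) * m) := by
  have hmid := two_rpow_midExponent_le h hm hm0
  have hH2 : (m.choose d' : ℝ) ≤ 2 ^ (H2 ((d' : ℝ) / m) * m) := choose_le_two_rpow (by omega)
  have hchoose : (m.choose d' : ℝ) * d'.choose d = m.choose d * (m - d).choose (d' - d) := by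
    exact_mod_cast Nat.choose_mul (n := m) h
  rw [sub_mul, Real.rpow_sub two_pos, mul_div_assoc', le_div_iff₀ (by positivity)]
  calc (m.choose d : ℝ) * 2 ^ (midExponent ((d : ℝ) / m) ((d' : ℝ) / m) * m)
      ≤ m.choose d * ((m + 1) * (2 ^ d * (m - d).choose (d' - d))) := by gcongr
    _ = (m + 1) * 2 ^ d * (m.choose d * (m - d).choose (d' - d)) := by ring
    _ = (m + 1) * (2 ^ d * d'.choose d) * m.choose d' := by rw [← hchoose]; ring
    _ ≤ _ := by gcongr

theorem two_pow_mul_descFactorial_le {k : ℕ} (hk : 1 ≤ k) (d : ℕ) :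
    2 ^ d * k.descFactorial d ≤ 2 * (2 * k - 1).descFactorial d := by
  induction d with
  | zero => simp
  | succ d ih =>
    rw [Nat.descFactorial_succ, Nat.descFactorial_succ]
    rcases Nat.eq_zero_or_pos d with rfl | hd
    · simp only [zero_add, pow_one, Nat.sub_zero, Nat.descFactorial_zero, mul_one]
      omega
    calc 2 ^ (d + 1) * ((k - d) * k.descFactorial d)
        = (2 * (k - d)) * (2 ^ d * k.descFactorial d) := by ring
      _ ≤ (2 * k - 1 - d) * (2 * (2 * k - 1).descFactorial d) :=
          Nat.mul_le_mul (by omega) ih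
      _ = _ := by ring

theorem descFactorial_le_two_rpow_sub_midExponent {m d d' : ℕ} (h : d ≤ d') (hd' : 1 ≤ d')
    (hm : 2 * d' ≤ m) :
    (m.descFactorial d : ℝ) ≤ 2 * (m + 1) * (2 * d' - 1).descFactorial d *
      2 ^ ((H2 ((d' : ℝ) / m) - midExponent ((d : ℝ) / m) ((d' : ℝ) / m)) * m) := by
  have hchoose := choose_le_two_rpow_sub_midExponent h hm (by omega)
  have hdesc : (2 : ℝ) ^ d * d'.descFactorial d ≤ 2 * (2 * d' - 1).descFactorial d := by
    exact_mod_cast two_pow_mul_descFactorial_le hd' d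
  rw [Nat.descFactorial_eq_factorial_mul_choose d'] at hdesc
  rw [Nat.descFactorial_eq_factorial_mul_choose m]
  push_cast at hdesc ⊢
  set z := (2 : ℝ) ^ ((H2 ((d' : ℝ) / m) - midExponent ((d : ℝ) / m) ((d' : ℝ) / m)) * m)
  calc (d.factorial : ℝ) * m.choose d
      ≤ d.factorial * ((m + 1) * (2 ^ d * d'.choose d) * z) := by gcongr
    _ = (m + 1) * z * (2 ^ d * (d.factorial * d'.choose d)) := by ring
    _ ≤ (m + 1) * z * (2 * (2 * d' - 1).descFactorial d) := by gcongr
    _ = _ := by ring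

/-! ### The Zyablov rate -/

theorem H2inv_mem_Icc_and_H2_H2inv {y : ℝ} (hy : y ∈ Set.Icc (0 : ℝ) 1) :
    H2inv y ∈ Set.Icc (0 : ℝ) (1 / 2) ∧ H2 (H2inv y) = y := by
  have hsurj : ∃ p ∈ Set.Icc (0 : ℝ) (1 / 2), H2 p = y := by
    have hcont : ContinuousOn H2 (Set.Icc (0 : ℝ) (1 / 2)) :=
      (Real.binEntropy_continuous.div_const _).continuousOn
    have := intermediate_value_Icc (by norm_num) hcont
    rw [H2_zero, H2_one_half] at this
    exact this hy
  exact ⟨Function.invFunOn_mem hsurj, Function.invFunOn_eq hsurj⟩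

theorem kappaZ_le_one_sub_H2 {δ : ℝ} (h0 : 0 ≤ δ) (h1 : δ ≤ 1) : kappaZ δ ≤ 1 - H2 δ := by
  refine Real.sSup_le ?_ (sub_nonneg.2 (H2_le_one δ))
  rintro _ ⟨κ, ⟨hκ0, hκ1⟩, rfl⟩
  have hH := H2_nonneg h0 h1
  have hinv : 0 ≤ H2inv (1 - κ) :=
    (H2inv_mem_Icc_and_H2_H2inv ⟨by linarith, by linarith⟩).1.1
  have := mul_nonneg hκ0.le (div_nonneg h0 hinv)
  simp only
  linarith

theorem kappaZ_nonpos {δ : ℝ} (h0 : 1 / 2 ≤ δ) (h1 : δ ≤ 1) : kappaZ δ ≤ 0 := by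
  refine Real.sSup_le ?_ le_rfl
  rintro _ ⟨κ, ⟨hκ0, hκ1⟩, rfl⟩
  have hH := H2_nonneg (by linarith) h1
  obtain ⟨⟨hinv0, hinv1⟩, hinv⟩ :=
    H2inv_mem_Icc_and_H2_H2inv (y := 1 - κ) ⟨by linarith, by linarith⟩
  have hne : H2inv (1 - κ) ≠ 0 := fun h => by
    rw [h, H2_zero] at hinv
    linarith
  have hquot : 1 ≤ δ / H2inv (1 - κ) := by
    rw [one_le_div (lt_of_le_of_ne hinv0 hne.symm)]
    linarith
  exact mul_nonpos_of_nonneg_of_nonpos hκ0.le (by linarith)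

/-! ### The Plotkin bound -/

theorem two_mul_sum_sum_ne_le {ι : Type*} (I : Finset ι) (f : ι → Bool) :
    2 * ∑ i ∈ I, ∑ j ∈ I, (if f i ≠ f j then 1 else 0) ≤ I.card ^ 2 := by
  set T := I.filter fun i => f i = true
  set F := I.filter fun i => ¬ f i = true
  have hTF : T.card + F.card = I.card := Finset.card_filter_add_card_filter_not _
  have hinner : ∀ i, ∑ j ∈ I, (if f i ≠ f j then 1 else 0) =
      if f i = true then F.card else T.card := by
    intro i
    rw [← Finset.card_filter]
    split_ifs with hi <;>
      exact congrArg Finset.card (Finset.filter_congr fun j _ => by cases hj : f j <;> simp [hi])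
  rw [Finset.sum_congr rfl fun i _ => hinner i, Finset.sum_ite, Finset.sum_const, Finset.sum_const,
    smul_eq_mul, smul_eq_mul, ← hTF]
  linarith [four_mul_le_sq_add T.card F.card, mul_comm T.card F.card]

section Plotkin

variable {ι κ : Type*} [Fintype κ] {I : Finset ι} {x : ι → κ → Bool}

theorem two_mul_sum_hammingDist_le {U : Finset κ}
    (hU : ∀ i ∈ I, ∀ j ∈ I, ∀ k ∉ U, x i k = x j k) :
    2 * ∑ i ∈ I, ∑ j ∈ I, hammingDist (x i) (x j) ≤ U.card * I.card ^ 2 := by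
  have hdist : ∀ i ∈ I, ∀ j ∈ I,
      hammingDist (x i) (x j) = ∑ k ∈ U, (if x i k ≠ x j k then 1 else 0) := by
    intro i hi j hj
    rw [← Finset.card_filter, hammingDist]
    congr 1
    ext k
    simp only [Finset.mem_filter, Finset.mem_univ, true_and, iff_and_self]
    exact fun h => by_contra fun hk => h (hU i hi j hj k hk)
  have hswap : ∑ i ∈ I, ∑ j ∈ I, hammingDist (x i) (x j) =
      ∑ k ∈ U, ∑ i ∈ I, ∑ j ∈ I, (if x i k ≠ x j k then 1 else 0) :=
    (Finset.sum_congr rfl fun i hi =>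
      (Finset.sum_congr rfl (hdist i hi)).trans Finset.sum_comm).trans Finset.sum_comm
  rw [hswap, Finset.mul_sum, ← smul_eq_mul, ← Finset.sum_const]
  exact Finset.sum_le_sum fun k _ => two_mul_sum_sum_ne_le I fun i => x i k

theorem card_mul_le_sum_hammingDist {d : ℕ}
    (hd : ∀ i ∈ I, ∀ j ∈ I, i ≠ j → d ≤ hammingDist (x i) (x j)) :
    I.card * ((I.card - 1) * d) ≤ ∑ i ∈ I, ∑ j ∈ I, hammingDist (x i) (x j) := by
  classical
  rw [← smul_eq_mul (a := I.card), ← Finset.sum_const]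
  refine Finset.sum_le_sum fun i hi => ?_
  calc (I.card - 1) * d = ∑ _j ∈ I.erase i, d := by
        rw [Finset.sum_const, Finset.card_erase_of_mem hi, smul_eq_mul]
    _ ≤ ∑ j ∈ I.erase i, hammingDist (x i) (x j) :=
        Finset.sum_le_sum fun j hj => hd i hi j (Finset.mem_of_mem_erase hj)
          (Finset.ne_of_mem_erase hj).symm
    _ ≤ _ := Finset.sum_le_sum_of_subset (Finset.erase_subset _ _)

theorem card_le_of_card_lt_two_mul {U : Finset κ} {d : ℕ} (hUd : U.card < 2 * d)
    (hd : ∀ i ∈ I, ∀ j ∈ I, i ≠ j → d ≤ hammingDist (x i) (x j))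
    (hU : ∀ i ∈ I, ∀ j ∈ I, ∀ k ∉ U, x i k = x j k) : I.card ≤ 2 * d := by
  rcases Nat.eq_zero_or_pos I.card with h0 | hpos
  · omega
  obtain ⟨N, hN⟩ : ∃ N, I.card = N + 1 := ⟨I.card - 1, by omega⟩
  have hsum : 2 * ((N + 1) * (N * d)) ≤ U.card * (N + 1) ^ 2 := by
    simpa only [hN, Nat.add_sub_cancel] using
      (Nat.mul_le_mul_left 2 (card_mul_le_sum_hammingDist hd)).trans (two_mul_sum_hammingDist_le hU)
  have hcancel : 2 * (N * d) ≤ U.card * (N + 1) := by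
    refine Nat.le_of_mul_le_mul_left ?_ (Nat.add_one_pos N)
    linarith
  have := Nat.mul_le_mul_right (N + 1) (Nat.succ_le_of_lt hUd)
  rw [hN]
  linarith

end Plotkin

theorem IsCode.card_le {m d : ℕ} {C : Finset (Cube m)} (hC : IsCode C d) (hd : m < 2 * d) :
    C.card ≤ 2 * d :=
  card_le_of_card_lt_two_mul (x := id) (U := Finset.univ) (by simpa using hd) hC
    fun _ _ _ _ k hk => absurd (Finset.mem_univ k) hk

/-! ### Gapped instances -/

namespace IsGappedInstance

variable {n m : ℕ} {x : Fin n → Cube m} {a b : Fin n} {dmin d2 : ℕ}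

theorem le_hammingDist (h : IsGappedInstance x a b dmin d2) {i j : Fin n} (hij : i ≠ j)
    (hne : ¬ ((i = a ∧ j = b) ∨ (i = b ∧ j = a))) : d2 ≤ hammingDist (x i) (x j) := by
  obtain ⟨-, -, -, -, hleast⟩ := h
  rcases lt_or_gt_of_ne hij with hlt | hlt
  · exact hleast ⟨i, j, hlt, fun he => hne (Or.inl (Prod.mk.injEq .. ▸ he)), rfl⟩
  · exact hleast ⟨j, i, hlt, fun he => hne (Or.inr (Prod.mk.injEq .. ▸ he).symm),
      hammingDist_comm _ _⟩

theorem eq_or_eq_of_hammingDist_le (h : IsGappedInstance x a b dmin d2) {i j : Fin n}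
    (hij : i ≠ j) (hd : hammingDist (x i) (x j) ≤ dmin) :
    (i = a ∧ j = b) ∨ (i = b ∧ j = a) :=
  by_contra fun hne => absurd ((h.le_hammingDist hij hne).trans hd) (not_le.2 h.2.2.1)

theorem le_hammingDist_of_ne_right (h : IsGappedInstance x a b dmin d2) {i j : Fin n}
    (hij : i ≠ j) (hi : i ≠ b) (hj : j ≠ b) : d2 ≤ hammingDist (x i) (x j) :=
  h.le_hammingDist hij (by tauto)

theorem d2_le (h : IsGappedInstance x a b dmin d2) : d2 ≤ m := by
  obtain ⟨i, j, -, -, hd⟩ := h.2.2.2.1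
  rw [← hd]
  simpa using hammingDist_le_card_fintype (x := x i) (y := x j)

theorem two_lt (h : IsGappedInstance x a b dmin d2) : 2 < n := by
  obtain ⟨i, j, hij, hne, -⟩ := h.2.2.2.1
  have hab := h.1
  by_contra hn
  apply hne
  rw [Fin.lt_def] at hij hab
  rw [Prod.mk.injEq, Fin.ext_iff, Fin.ext_iff]
  omega

theorem card_le_two_pow (h : IsGappedInstance x a b dmin d2) : n ≤ 2 ^ m + 1 := by
  have hinj : Set.InjOn x (Finset.univ.erase b : Finset (Fin n)) := by
    intro i hi j hj hij
    by_contra hne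
    have hpos : 0 < d2 := (Nat.zero_le _).trans_lt h.2.2.1
    have hle := h.le_hammingDist_of_ne_right hne (Finset.ne_of_mem_erase hi)
      (Finset.ne_of_mem_erase hj)
    rw [hij, hammingDist_self] at hle
    omega
  have hcard := Finset.card_le_card_of_injOn x
    (fun _ _ => Finset.mem_coe.2 (Finset.mem_univ _)) hinj
  rw [Finset.card_erase_of_mem (Finset.mem_univ b), Finset.card_univ, Finset.card_univ,
    Fintype.card_fin, Fintype.card_fun, Fintype.card_bool, Fintype.card_fin] at hcard
  omega

theorem card_le_of_agree_off (h : IsGappedInstance x a b dmin d2) {I : Finset (Fin n)}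
    {U : Finset (Fin m)} (hUd : U.card < 2 * d2)
    (hU : ∀ i ∈ I, ∀ j ∈ I, ∀ k ∉ U, x i k = x j k) : I.card ≤ 2 * d2 + 1 := by
  have herase : (I.erase b).card ≤ 2 * d2 :=
    card_le_of_card_lt_two_mul hUd
      (fun i hi j hj hij => h.le_hammingDist_of_ne_right hij (Finset.ne_of_mem_erase hi)
        (Finset.ne_of_mem_erase hj))
      fun i hi j hj => hU i (Finset.mem_of_mem_erase hi) j (Finset.mem_of_mem_erase hj)
  have := Finset.pred_card_le_card_erase (s := I) (a := b)
  omega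

end IsGappedInstance

/-! ### Random selection of coordinates -/

theorem sum_range_mul_mod_div {M : Type*} [AddCommMonoid M] (a b : ℕ) (F : ℕ → ℕ → M) :
    ∑ r ∈ Finset.range (a * b), F (r % a) (r / a) =
      ∑ q ∈ Finset.range b, ∑ i ∈ Finset.range a, F i q := by
  induction b with
  | zero => simp
  | succ b ih =>
    rw [mul_add_one, Finset.sum_range_add, ih, Finset.sum_range_succ]
    congr 1
    refine Finset.sum_congr rfl fun i hi => ?_
    have hia := Finset.mem_range.1 hi
    rw [Nat.mul_add_mod, Nat.mod_eq_of_lt hia, Nat.mul_add_div (by omega), Nat.div_eq_of_lt hia,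
      add_zero]

/-- A set of at most `u` elements of `{0, …, p - 1}`, read off the mixed radix digits
`r % p, r / p % (p - 1), …` of `r`: the element `p - 1` is taken if the first digit is less than
`u`, and then `u` drops by one.  If `u ≤ p` and `r` is uniform below `p!`, it is a uniformly random
`u`-element subset. -/
def selection : ℕ → ℕ → ℕ → Finset ℕ
  | 0, _, _ => ∅
  | p + 1, u, r =>
    if r % (p + 1) < u then insert p (selection p (u - 1) (r / (p + 1)))
    else selection p u (r / (p + 1))

theorem selection_subset_range (p u r : ℕ) : selection p u r ⊆ Finset.range p := by
  induction p generalizing u r with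
  | zero => rw [selection, Finset.range_zero]
  | succ p ih =>
    have hs := fun u r => (ih u r).trans (Finset.range_subset_range.2 (Nat.le_succ p))
    rw [selection]
    split_ifs
    · exact Finset.insert_subset (Finset.self_mem_range_succ p) (hs _ _)
    · exact hs _ _

theorem card_selection_le (p u r : ℕ) : (selection p u r).card ≤ u := by
  induction p generalizing u r with
  | zero => rw [selection, Finset.card_empty]; exact Nat.zero_le u
  | succ p ih =>
    rw [selection]
    split_ifs with h
    · have := ih (u - 1) (r / (p + 1))
      exact (Finset.card_insert_le _ _).trans (by omega)
    · exact ih _ _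

theorem selection_mod_factorial (p u r : ℕ) :
    selection p u (r % p.factorial) = selection p u r := by
  induction p generalizing u r with
  | zero => rfl
  | succ p ih =>
    rw [selection, selection, Nat.factorial_succ, Nat.mod_mul_right_mod,
      Nat.mod_mul_right_div_self, ih, ih]

/-- The number of digit strings `r < p!` whose selection contains `D`. -/
def selectionCount (p u : ℕ) (D : Finset ℕ) : ℕ :=
  ((Finset.range p.factorial).filter fun r => D ⊆ selection p u r).card

theorem selectionCount_succ {p u : ℕ} (hu : u ≤ p + 1) (D : Finset ℕ) :
    selectionCount (p + 1) u D =
      u * selectionCount p (u - 1) (D.erase p) + (p + 1 - u) * selectionCount p u D := by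
  have hsplit : ∀ i q, (if D ⊆ (if i < u then insert p (selection p (u - 1) q)
        else selection p u q) then 1 else 0) =
      if i < u then (if D.erase p ⊆ selection p (u - 1) q then 1 else 0)
        else if D ⊆ selection p u q then 1 else 0 := by
    intro i q
    by_cases h : i < u
    · simp only [h, if_true, Finset.subset_insert_iff]
    · simp only [h, if_false]
  have hlt : (Finset.range (p + 1)).filter (· < u) = Finset.range u := by
    ext i; simp only [Finset.mem_filter, Finset.mem_range]; omega
  have hge : ((Finset.range (p + 1)).filter fun i => ¬ i < u).card = p + 1 - u := by
    have := Finset.card_filter_add_card_filter_not (s := Finset.range (p + 1)) (· < u)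
    rw [hlt, Finset.card_range, Finset.card_range] at this
    omega
  calc selectionCount (p + 1) u D
      = ∑ q ∈ Finset.range p.factorial, ∑ i ∈ Finset.range (p + 1),
          if D ⊆ (if i < u then insert p (selection p (u - 1) q) else selection p u q)
          then 1 else 0 := by
        rw [selectionCount, Finset.card_filter, Nat.factorial_succ]
        exact sum_range_mul_mod_div (p + 1) p.factorial fun i q =>
          if D ⊆ (if i < u then insert p (selection p (u - 1) q) else selection p u q)
          then 1 else 0
    _ = ∑ q ∈ Finset.range p.factorial,
          (u * (if D.erase p ⊆ selection p (u - 1) q then 1 else 0) +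
            (p + 1 - u) * (if D ⊆ selection p u q then 1 else 0)) := by
        refine Finset.sum_congr rfl fun q _ => ?_
        rw [Finset.sum_congr rfl fun i _ => hsplit i q, Finset.sum_ite, Finset.sum_const,
          Finset.sum_const, hlt, hge, Finset.card_range, smul_eq_mul, smul_eq_mul]
    _ = _ := by
        rw [Finset.sum_add_distrib, ← Finset.mul_sum, ← Finset.mul_sum, selectionCount,
          selectionCount, Finset.card_filter, Finset.card_filter]

theorem succ_mul_descFactorial_pred (u d : ℕ) :
    u * (u - 1).descFactorial d = u.descFactorial (d + 1) := by
  cases u with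
  | zero => simp
  | succ u => rw [Nat.succ_descFactorial_succ, Nat.add_sub_cancel]

theorem selectionCount_eq {p u : ℕ} (hu : u ≤ p) {D : Finset ℕ} (hD : D ⊆ Finset.range p) :
    selectionCount p u D = u.descFactorial D.card * (p - D.card).factorial := by
  induction p generalizing u D with
  | zero =>
    obtain rfl : D = ∅ := by simpa using hD
    simp [selectionCount]
  | succ p ih =>
    have hD' : D.erase p ⊆ Finset.range p := by
      rw [← Finset.subset_insert_iff, ← Finset.range_add_one]
      exact hD
    rw [selectionCount_succ hu, ih (by omega) hD']
    by_cases hp : p ∈ D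
    · have hnone : selectionCount p u D = 0 := by
        rw [selectionCount, Finset.card_eq_zero, Finset.filter_eq_empty_iff]
        exact fun q _ hq => Finset.notMem_range_self (selection_subset_range p u q (hq hp))
      obtain ⟨d, hd⟩ := Nat.exists_eq_add_one.2 (Finset.card_pos.2 ⟨p, hp⟩)
      rw [hnone, Finset.card_erase_of_mem hp, hd, Nat.add_sub_cancel, Nat.add_sub_add_right,
        mul_zero, add_zero, ← mul_assoc, succ_mul_descFactorial_pred]
    · rw [Finset.erase_eq_of_notMem hp] at hD' ⊢
      have hcard : D.card ≤ p := by simpa using Finset.card_le_card hD'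
      have hskip : (p + 1 - u) * selectionCount p u D =
          (p + 1 - u) * (u.descFactorial D.card * (p - D.card).factorial) := by
        rcases Nat.lt_or_ge p u with h | h
        · rw [show p + 1 - u = 0 by omega, zero_mul, zero_mul]
        · rw [ih h hD']
      rw [hskip, ← mul_assoc, succ_mul_descFactorial_pred, Nat.descFactorial_succ,
        Nat.succ_sub hcard, Nat.factorial_succ]
      rcases Nat.lt_or_ge u D.card with h | h
      · simp [Nat.descFactorial_of_lt h]
      · have hsum : p - D.card + 1 = (u - D.card) + (p + 1 - u) := by omega
        rw [hsum]
        ring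

theorem div_mul_card_filter_le (M B : ℕ) (P : ℕ → Prop) [DecidablePred P] :
    B / M * ((Finset.range M).filter P).card ≤
      ((Finset.range B).filter fun r => P (r % M)).card := by
  calc B / M * ((Finset.range M).filter P).card
      = ((Finset.range (M * (B / M))).filter fun r => P (r % M)).card := by
        rw [Finset.card_filter, Finset.card_filter,
          sum_range_mul_mod_div M (B / M) fun i _ => if P i then 1 else 0, Finset.sum_const,
          Finset.card_range, smul_eq_mul]
    _ ≤ _ := Finset.card_le_card
        (Finset.filter_subset_filter _ (Finset.range_subset_range.2 (Nat.mul_div_le B M)))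

theorem le_two_mul_mul_div {M B : ℕ} (hM : 0 < M) (h : M ≤ B) : B ≤ 2 * (M * (B / M)) := by
  have hdiv := Nat.div_add_mod B M
  have hmod := Nat.mod_lt B hM
  have hone : M * 1 ≤ M * (B / M) := Nat.mul_le_mul_left _ (Nat.div_pos h hM)
  omega

-- The factor `2` pays for `B` not being a multiple of `m!`.
theorem mul_descFactorial_le_card_subset_selection {m u B : ℕ} (hu : u ≤ m) (hB : m.factorial ≤ B)
    {D : Finset ℕ} (hD : D ⊆ Finset.range m) :
    B * u.descFactorial D.card ≤ 2 * m.descFactorial D.card *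
      ((Finset.range B).filter fun r => D ⊆ selection m u r).card := by
  have hd : D.card ≤ m := by simpa using Finset.card_le_card hD
  have hcount := div_mul_card_filter_le m.factorial B fun r => D ⊆ selection m u r
  simp only [selection_mod_factorial] at hcount
  rw [← selectionCount, selectionCount_eq hu hD] at hcount
  refine Nat.le_of_mul_le_mul_left ?_ (Nat.factorial_pos (m - D.card))
  calc (m - D.card).factorial * (B * u.descFactorial D.card)
      = B * (u.descFactorial D.card * (m - D.card).factorial) := by ring
    _ ≤ 2 * (m.factorial * (B / m.factorial)) *
        (u.descFactorial D.card * (m - D.card).factorial) :=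
        Nat.mul_le_mul_right _ (le_two_mul_mul_div m.factorial_pos hB)
    _ = 2 * m.factorial * (B / m.factorial *
        (u.descFactorial D.card * (m - D.card).factorial)) := by ring
    _ ≤ 2 * m.factorial * _ := Nat.mul_le_mul_left _ hcount
    _ = _ := by rw [← Nat.factorial_mul_descFactorial hd]; ring

/-! ### Blocks of coin tosses -/

/-- The number with binary digits `ω c, …, ω (c + N - 1)`, most significant digit first: a block of
`N` coin tosses, read as a random number below `2 ^ N`. -/
def coinNum (ω : ℕ → Bool) (c : ℕ) : ℕ → ℕ
  | 0 => 0
  | N + 1 => 2 * coinNum ω c N + (ω (c + N)).toNat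

theorem coinNum_lt (ω : ℕ → Bool) (c N : ℕ) : coinNum ω c N < 2 ^ N := by
  induction N with
  | zero => exact Nat.one_pos
  | succ N ih =>
    have := Bool.toNat_le (ω (c + N))
    rw [coinNum, pow_succ]
    omega

theorem coinNum_add (ω : ℕ → Bool) (c N : ℕ) :
    coinNum ω 0 (c + N) = coinNum ω c N + 2 ^ N * coinNum ω 0 c := by
  induction N with
  | zero => simp [coinNum]
  | succ N ih =>
    rw [← add_assoc, coinNum, ih, coinNum, zero_add, pow_succ]
    ring

theorem eq_of_coinNum_eq {ω ω' : ℕ → Bool} {N : ℕ} (h : coinNum ω 0 N = coinNum ω' 0 N) :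
    ∀ i < N, ω i = ω' i := by
  induction N with
  | zero => exact fun i hi => absurd hi (Nat.not_lt_zero i)
  | succ N ih =>
    simp only [coinNum, zero_add] at h
    have hω := Bool.toNat_le (ω N)
    have hω' := Bool.toNat_le (ω' N)
    intro i hi
    rcases Nat.lt_succ_iff_lt_or_eq.1 hi with hi | rfl
    · exact ih (by omega) i hi
    · have htoNat : (ω i).toNat = (ω' i).toNat := by omega
      revert htoNat
      cases ω i <;> cases ω' i <;> decide

namespace RAM

instance : MeasureTheory.IsProbabilityMeasure coinLaw := by
  unfold coinLaw; infer_instance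

theorem coinLaw_coinNum_eq_le (N v : ℕ) :
    coinLaw.real {ω | coinNum ω 0 N = v} ≤ 2⁻¹ ^ N := by
  rcases Set.eq_empty_or_nonempty {ω | coinNum ω 0 N = v} with hempty | ⟨ω', hω'⟩
  · rw [hempty, MeasureTheory.measureReal_empty]
    positivity
  have hsub : {ω | coinNum ω 0 N = v} ⊆
      Set.pi (Finset.range N : Finset ℕ) fun i => {ω' i} := fun ω hω i hi =>
    eq_of_coinNum_eq (Eq.trans hω (Eq.symm hω')) i (Finset.mem_range.1 hi)
  refine (MeasureTheory.measureReal_mono hsub).trans (le_of_eq ?_)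
  rw [MeasureTheory.measureReal_def, coinLaw,
    MeasureTheory.Measure.infinitePi_pi _ fun i _ => MeasurableSet.of_discrete]
  simp

theorem coinLaw_coinNum_mem_le (N : ℕ) (F : Finset ℕ) :
    coinLaw.real {ω | coinNum ω 0 N ∈ F} ≤ F.card / 2 ^ N := by
  have hunion : {ω : ℕ → Bool | coinNum ω 0 N ∈ F} = ⋃ v ∈ F, {ω | coinNum ω 0 N = v} := by
    ext ω
    simp
  rw [hunion]
  calc _ ≤ ∑ v ∈ F, coinLaw.real {ω | coinNum ω 0 N = v} :=
        MeasureTheory.measureReal_biUnion_finset_le _ _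
    _ ≤ ∑ _v ∈ F, (2 : ℝ)⁻¹ ^ N := Finset.sum_le_sum fun v _ => coinLaw_coinNum_eq_le N v
    _ = _ := by rw [Finset.sum_const, nsmul_eq_mul, inv_pow, div_eq_mul_inv]

/-- The numbers below `B ^ R` all of whose `R` digits in base `B` avoid `G`. -/
def avoiding (B : ℕ) (G : Finset ℕ) : ℕ → Finset ℕ
  | 0 => {0}
  | R + 1 => (Finset.range (B * B ^ R)).filter fun v => v % B ∉ G ∧ v / B ∈ avoiding B G R

theorem avoiding_subset_range (B : ℕ) (G : Finset ℕ) (R : ℕ) :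
    avoiding B G R ⊆ Finset.range (B ^ R) := by
  cases R with
  | zero => simp [avoiding]
  | succ R => rw [avoiding, pow_succ']; exact Finset.filter_subset _ _

theorem card_avoiding {B : ℕ} {G : Finset ℕ} (hG : G ⊆ Finset.range B) (R : ℕ) :
    (avoiding B G R).card = (B - G.card) ^ R := by
  induction R with
  | zero => simp [avoiding]
  | succ R ih =>
    have hdigit : ((Finset.range B).filter fun i => i ∉ G).card = B - G.card := by
      rw [Finset.filter_notMem_eq_sdiff, Finset.card_sdiff_of_subset hG, Finset.card_range]
    have hrest : (Finset.range (B ^ R)).filter (fun q => q ∈ avoiding B G R) = avoiding B G R := by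
      rw [Finset.filter_mem_eq_inter, Finset.inter_eq_right]
      exact avoiding_subset_range B G R
    calc (avoiding B G (R + 1)).card
        = ∑ q ∈ Finset.range (B ^ R), ∑ i ∈ Finset.range B,
            if i ∉ G ∧ q ∈ avoiding B G R then 1 else 0 := by
          rw [avoiding, Finset.card_filter]
          exact sum_range_mul_mod_div B (B ^ R) fun i q =>
            if i ∉ G ∧ q ∈ avoiding B G R then 1 else 0
      _ = ∑ q ∈ Finset.range (B ^ R), if q ∈ avoiding B G R then B - G.card else 0 := by
          refine Finset.sum_congr rfl fun q _ => ?_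
          split_ifs with hq
          · simp only [hq, and_true, ← Finset.card_filter, hdigit]
          · simp only [hq, and_false, if_false, Finset.sum_const_zero]
      _ = (B - G.card) ^ (R + 1) := by
          rw [← Finset.sum_filter, hrest, Finset.sum_const, ih, smul_eq_mul, pow_succ]

theorem coinNum_mem_avoiding {ω : ℕ → Bool} {K R : ℕ} {G : Finset ℕ}
    (h : ∀ ρ < R, coinNum ω (ρ * K) K ∉ G) : coinNum ω 0 (R * K) ∈ avoiding (2 ^ K) G R := by
  induction R with
  | zero => simp [avoiding, coinNum]
  | succ R ih =>
    have hlast := coinNum_lt ω (R * K) K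
    have hlt : coinNum ω 0 ((R + 1) * K) < 2 ^ K * (2 ^ K) ^ R := by
      rw [← pow_succ', ← pow_mul, mul_comm K]
      exact coinNum_lt ω 0 ((R + 1) * K)
    rw [avoiding, Finset.mem_filter, Finset.mem_range]
    refine ⟨hlt, ?_⟩
    rw [add_one_mul, coinNum_add ω (R * K) K, Nat.add_mul_mod_self_left, Nat.mod_eq_of_lt hlast,
      Nat.add_mul_div_left _ _ (by positivity), Nat.div_eq_of_lt hlast, zero_add]
    exact ⟨h R (Nat.lt_succ_self R), ih fun ρ hρ => h ρ (Nat.lt_succ_of_lt hρ)⟩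

theorem one_sub_pow_le_coinLaw_exists_block {K : ℕ} {G : Finset ℕ}
    (hG : G ⊆ Finset.range (2 ^ K)) (R : ℕ) :
    1 - (1 - (G.card : ℝ) / 2 ^ K) ^ R ≤
      coinLaw.real {ω | ∃ ρ < R, coinNum ω (ρ * K) K ∈ G} := by
  set S : Set (ℕ → Bool) := {ω | ∃ ρ < R, coinNum ω (ρ * K) K ∈ G}
  have hle : G.card ≤ 2 ^ K := by simpa using Finset.card_le_card hG
  have hcompl : coinLaw.real Sᶜ ≤ (1 - (G.card : ℝ) / 2 ^ K) ^ R := by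
    calc coinLaw.real Sᶜ ≤ coinLaw.real {ω | coinNum ω 0 (R * K) ∈ avoiding (2 ^ K) G R} :=
          MeasureTheory.measureReal_mono fun ω hω =>
            coinNum_mem_avoiding fun ρ hρ hmem => hω ⟨ρ, hρ, hmem⟩
      _ ≤ (avoiding (2 ^ K) G R).card / 2 ^ (R * K) := coinLaw_coinNum_mem_le _ _
      _ = ((2 ^ K - G.card) / 2 ^ K) ^ R := by
          rw [card_avoiding hG, mul_comm R K, pow_mul, Nat.cast_pow, Nat.cast_sub hle, ← div_pow,
            Nat.cast_pow, Nat.cast_ofNat]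
      _ = _ := by rw [sub_div, div_self (by positivity)]
  have hunion : 1 ≤ coinLaw.real S + coinLaw.real Sᶜ := by
    have := MeasureTheory.measureReal_union_le (μ := coinLaw) S Sᶜ
    rwa [Set.union_compl_self, MeasureTheory.probReal_univ] at this
  linarith

end RAM

/-! ### Reasoning about programs -/

namespace RAM

theorem State.setReg_reg (s : State) (r v q : ℕ) :
    (s.setReg r v).reg q = if q = r then v else s.reg q :=
  Function.update_apply _ _ _ _

theorem State.setMem_mem (s : State) (i v j : ℕ) :
    (s.setMem i v).mem j = if j = i then v else s.mem j :=
  Function.update_apply _ _ _ _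

/-- The size of an expression: its number of nodes as a syntax tree. -/
def Expr.nodes : Expr → ℕ
  | .lit _ => 1
  | .reg _ => 1
  | .load e => e.nodes + 1
  | .bin _ e f => e.nodes + f.nodes + 1

/-- The size of a program: its number of nodes as a syntax tree. -/
def Cmd.nodes : Cmd → ℕ
  | .skip => 1
  | .assign _ e => e.nodes + 1
  | .store f e => f.nodes + e.nodes + 1
  | .flip _ => 1
  | .query f g => f.nodes + g.nodes + 1
  | .seq c c' => c.nodes + c'.nodes
  | .ite e c c' => e.nodes + c.nodes + c'.nodes
  | .loop e c => e.nodes + c.nodes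

/-- The result of the operation has at most `S` bits if its operands have. -/
def Op.Fits (S : ℕ) : Op → ℕ → ℕ → Prop
  | .add, u, v => u + v < 2 ^ S
  | .sub, _, _ => True
  | .mul, u, v => u * v < 2 ^ S
  | .div, _, _ => True
  | .mod, _, _ => True

/-- All numbers that occur in the evaluation of the expression have at most `S` bits. -/
def Expr.Fits (s : State) (S : ℕ) : Expr → Prop
  | .lit k => k < 2 ^ S
  | .reg r => s.reg r < 2 ^ S
  | .load e => e.Fits s S ∧ s.mem (e.eval s) < 2 ^ S
  | .bin op e f => e.Fits s S ∧ f.Fits s S ∧ op.Fits S (e.eval s) (f.eval s)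

theorem Op.Fits.eval_lt {S u v : ℕ} {op : Op} (h : op.Fits S u v) (hu : u < 2 ^ S) :
    op.eval u v < 2 ^ S := by
  cases op with
  | add => exact h
  | sub => exact (Nat.sub_le u v).trans_lt hu
  | mul => exact h
  | div => exact (Nat.div_le_self u v).trans_lt hu
  | mod => exact (Nat.mod_le u v).trans_lt hu

theorem Expr.Fits.eval_lt {s : State} {S : ℕ} {e : Expr} (h : e.Fits s S) : e.eval s < 2 ^ S := by
  induction e with
  | lit k => exact h
  | reg r => exact h
  | load e _ => exact h.2
  | bin op e f ihe _ => exact h.2.2.eval_lt (ihe h.1)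

theorem Expr.Fits.size_le {s : State} {S : ℕ} {e : Expr} (h : e.Fits s S) :
    (e.eval s).size ≤ S :=
  Nat.size_le.2 h.eval_lt

theorem Op.cost_le {S u v : ℕ} (op : Op) (hu : u.size ≤ S) (hv : v.size ≤ S) :
    op.cost u v ≤ (S + 1) ^ 2 := by
  have hlin : 1 + u.size + v.size ≤ (S + 1) ^ 2 := by nlinarith
  have hquad : (1 + u.size) * (1 + v.size) ≤ (S + 1) ^ 2 := by
    rw [sq]; exact Nat.mul_le_mul (by omega) (by omega)
  cases op <;> assumption

theorem Expr.Fits.cost_le {s : State} {S : ℕ} {e : Expr} (h : e.Fits s S) :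
    e.cost s ≤ 2 * e.nodes * (S + 1) ^ 2 := by
  have hS : S + 1 ≤ (S + 1) ^ 2 := Nat.le_self_pow two_ne_zero _
  induction e with
  | lit k =>
    have hk : k.size ≤ S := Nat.size_le.2 h
    simp only [Expr.cost, Expr.nodes]
    omega
  | reg r =>
    have hr : (s.reg r).size ≤ S := Nat.size_le.2 h
    simp only [Expr.cost, Expr.nodes]
    omega
  | load e ih =>
    have haddr : (e.eval s).size ≤ S := h.1.size_le
    have hval : (s.mem (e.eval s)).size ≤ S := Nat.size_le.2 h.2
    have he := ih h.1
    simp only [Expr.cost, Expr.nodes, mul_add, add_mul]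
    omega
  | bin op e f ihe ihf =>
    have he := ihe h.1
    have hf := ihf h.2.1
    have hop := op.cost_le h.1.size_le h.2.1.size_le
    simp only [Expr.cost, Expr.nodes, mul_add, add_mul]
    omega

/-- The time allotted to each node of a program when all numbers have at most `S` bits. -/
def stepTime (S : ℕ) : ℕ := 3 * (S + 1) ^ 2

theorem Expr.Fits.cost_add_le {s : State} {S : ℕ} {e : Expr} (h : e.Fits s S) :
    e.cost s + 1 + (e.eval s).size ≤ e.nodes * stepTime S := by
  have hcost := h.cost_le
  have hsize := h.size_le
  have hnodes : 1 ≤ e.nodes := by cases e <;> simp [Expr.nodes]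
  have hS : S + 1 ≤ (S + 1) ^ 2 := Nat.le_self_pow two_ne_zero _
  have hone := Nat.mul_le_mul hnodes hS
  rw [mul_assoc] at hcost
  rw [stepTime, mul_left_comm]
  omega

/-- All numbers that occur in the evaluation of the expression have at most `S` bits, and
its value is `v`. -/
def Expr.Evals (S : ℕ) (s : State) (e : Expr) (v : ℕ) : Prop :=
  e.Fits s S ∧ e.eval s = v

namespace Expr.Evals

variable {S : ℕ} {s : State} {e f : Expr} {u v : ℕ}

theorem lit {k : ℕ} (hk : k < 2 ^ S) : (Expr.lit k).Evals S s k := ⟨hk, rfl⟩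

theorem reg {r : ℕ} (h : s.reg r = v) (hv : v < 2 ^ S) : (Expr.reg r).Evals S s v :=
  ⟨by rwa [Fits, h], h⟩

theorem load (he : e.Evals S s u) (h : s.mem u = v) (hv : v < 2 ^ S) :
    (Expr.load e).Evals S s v := by
  obtain ⟨hfit, rfl⟩ := he
  exact ⟨⟨hfit, h ▸ hv⟩, h⟩

theorem bin {op : Op} (he : e.Evals S s u) (hf : f.Evals S s v) (h : op.Fits S u v) :
    (Expr.bin op e f).Evals S s (op.eval u v) := by
  obtain ⟨hfit, rfl⟩ := he
  obtain ⟨hfit', rfl⟩ := hf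
  exact ⟨⟨hfit, hfit', h⟩, rfl⟩

end Expr.Evals

/-- The program assigns to register `q`. -/
def Cmd.assigns (q : ℕ) : Cmd → Bool
  | .assign r _ => r == q
  | .flip r => r == q
  | .seq c c' => c.assigns q || c'.assigns q
  | .ite _ c c' => c.assigns q || c'.assigns q
  | .loop _ c => c.assigns q
  | _ => false

/-- The program writes to the memory. -/
def Cmd.stores : Cmd → Bool
  | .store _ _ => true
  | .query _ _ => true
  | .seq c c' => c.stores || c'.stores
  | .ite _ c c' => c.stores || c'.stores
  | .loop _ c => c.stores
  | _ => false

/-- The program tosses coins. -/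
def Cmd.flips : Cmd → Bool
  | .flip _ => true
  | .seq c c' => c.flips || c'.flips
  | .ite _ c c' => c.flips || c'.flips
  | .loop _ c => c.flips
  | _ => false

/-- The states `s` and `s'` agree in everything that the program `c` does not write to. -/
structure Cmd.Frame (c : Cmd) (s s' : State) : Prop where
  reg : ∀ q, c.assigns q = false → s'.reg q = s.reg q
  mem : c.stores = false → s'.mem = s.mem
  coins : c.flips = false → s'.coins = s.coins

namespace Cmd.Frame

variable {c c' : Cmd} {s s' s'' : State}

theorem refl (c : Cmd) (s : State) : c.Frame s s := ⟨fun _ _ => rfl, fun _ => rfl, fun _ => rfl⟩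

theorem trans (h : c.Frame s s') (h' : c.Frame s' s'') : c.Frame s s'' :=
  ⟨fun q hq => (h'.reg q hq).trans (h.reg q hq), fun hc => (h'.mem hc).trans (h.mem hc),
    fun hc => (h'.coins hc).trans (h.coins hc)⟩

theorem seq_left (h : c.Frame s s') : (c.seq c').Frame s s' :=
  ⟨fun q hq => h.reg q (Bool.or_eq_false_iff.1 hq).1,
    fun hc => h.mem (Bool.or_eq_false_iff.1 hc).1, fun hc => h.coins (Bool.or_eq_false_iff.1 hc).1⟩

theorem seq_right (h : c'.Frame s s') : (c.seq c').Frame s s' :=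
  ⟨fun q hq => h.reg q (Bool.or_eq_false_iff.1 hq).2,
    fun hc => h.mem (Bool.or_eq_false_iff.1 hc).2, fun hc => h.coins (Bool.or_eq_false_iff.1 hc).2⟩

theorem loop {e : Expr} (h : c.Frame s s') : (Cmd.loop e c).Frame s s' :=
  ⟨h.reg, h.mem, h.coins⟩

theorem setReg (s : State) (r v : ℕ) (e : Expr) : (Cmd.assign r e).Frame s (s.setReg r v) := by
  refine ⟨fun q hq => ?_, fun _ => rfl, fun _ => rfl⟩
  rw [State.setReg_reg, if_neg]
  rintro rfl
  simp [Cmd.assigns] at hq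

end Cmd.Frame

theorem Exec.frame {m : ℕ} {dec : Cube m → Cube m} {ω : ℕ → Bool} {c : Cmd} {s s' : State} {t : ℕ}
    (h : Exec dec ω c s s' t) : c.Frame s s' := by
  induction h with
  | skip s => exact .refl _ s
  | assign r e s => exact .setReg s r _ e
  | store f e s => exact ⟨fun _ _ => rfl, nofun, fun _ => rfl⟩
  | flip r s => exact ⟨(Cmd.Frame.setReg s r _ (.lit 0)).reg, fun _ => rfl, nofun⟩
  | query f g s => exact ⟨fun _ _ => rfl, nofun, fun _ => rfl⟩
  | seq _ _ _ _ _ _ _ _ _ ih ih' => exact ih.seq_left.trans ih'.seq_right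
  | iteTrue _ c c' s s' _ _ _ ih =>
    have hseq : (c.seq c').Frame s s' := ih.seq_left
    exact ⟨hseq.reg, hseq.mem, hseq.coins⟩
  | iteFalse _ c c' s s' _ _ _ ih =>
    have hseq : (c.seq c').Frame s s' := ih.seq_right
    exact ⟨hseq.reg, hseq.mem, hseq.coins⟩
  | loopDone _ _ s _ => exact .refl _ s
  | loopStep _ _ _ _ _ _ _ _ _ _ ih ih' => exact ih.loop.trans ih'

/-- Started in the state `s`, the program halts in a state that satisfies `Q`, within the time
that suffices to execute each of its nodes at most `K` times on numbers of at most `S` bits. -/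
def Runs {m : ℕ} (dec : Cube m → Cube m) (ω : ℕ → Bool) (S : ℕ) (c : Cmd) (s : State) (K : ℕ)
    (Q : State → Prop) : Prop :=
  ∃ s' t, Exec dec ω c s s' t ∧ t ≤ K * (c.nodes * stepTime S) ∧ Q s'

namespace Runs

variable {m : ℕ} {dec : Cube m → Cube m} {ω : ℕ → Bool} {s : State} {S K K' v w : ℕ}
  {c c' : Cmd} {e f : Expr} {Q Q' : State → Prop}

theorem mono (h : Runs dec ω S c s K Q) (hK : K ≤ K') (hQ : ∀ s', c.Frame s s' → Q s' → Q' s') :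
    Runs dec ω S c s K' Q' := by
  obtain ⟨s', t, hx, ht, hq⟩ := h
  exact ⟨s', t, hx, ht.trans (Nat.mul_le_mul_right _ hK), hQ s' hx.frame hq⟩

theorem of_le {t : ℕ} {s' : State} (h : Exec dec ω c s s' t) (hK : 0 < K)
    (ht : t ≤ c.nodes * stepTime S) (hQ : Q s') : Runs dec ω S c s K Q :=
  ⟨s', t, h, ht.trans (Nat.le_mul_of_pos_left _ hK), hQ⟩

theorem stepTime_ge (S : ℕ) : 3 ≤ stepTime S := by
  rw [stepTime]
  have := Nat.one_le_pow 2 (S + 1) (by omega)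
  omega

theorem skip (hK : 0 < K) (h : Q s) : Runs dec ω S .skip s K Q :=
  of_le (.skip s) hK (by have := stepTime_ge S; simp only [Cmd.nodes]; omega) h

theorem flip {r : ℕ} (hK : 0 < K)
    (h : Q { s.setReg r (ω s.coins).toNat with coins := s.coins + 1 }) :
    Runs dec ω S (.flip r) s K Q :=
  of_le (.flip r s) hK (by have := stepTime_ge S; simp only [Cmd.nodes]; omega) h

theorem assign {r : ℕ} (hK : 0 < K) (he : e.Evals S s v) (h : Q (s.setReg r v)) :
    Runs dec ω S (.assign r e) s K Q := by
  obtain ⟨hfit, rfl⟩ := he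
  refine of_le (.assign r e s) hK ?_ h
  have := hfit.cost_add_le
  simp only [Cmd.nodes, add_one_mul]
  omega

theorem store (hK : 0 < K) (hf : f.Evals S s w) (he : e.Evals S s v) (h : Q (s.setMem w v)) :
    Runs dec ω S (.store f e) s K Q := by
  obtain ⟨hfit, rfl⟩ := he
  obtain ⟨hfit', rfl⟩ := hf
  refine of_le (.store f e s) hK ?_ h
  have := hfit.cost_add_le
  have := hfit'.cost_add_le
  simp only [Cmd.nodes, add_mul]
  omega

theorem seq (h : Runs dec ω S c s K Q)
    (h' : ∀ s', c.Frame s s' → Q s' → Runs dec ω S c' s' K Q') :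
    Runs dec ω S (.seq c c') s K Q' := by
  obtain ⟨s', t, hx, ht, hq⟩ := h
  obtain ⟨s'', t', hx', ht', hq'⟩ := h' s' hx.frame hq
  refine ⟨s'', _, .seq c c' s s' s'' t t' hx hx', ?_, hq'⟩
  rw [Cmd.nodes, add_mul, mul_add]
  omega

theorem assign_seq {r : ℕ} (hK : 0 < K) (he : e.Evals S s v)
    (h : Runs dec ω S c (s.setReg r v) K Q) : Runs dec ω S (.seq (.assign r e) c) s K Q :=
  seq (Q := (· = s.setReg r v)) (assign hK he rfl) fun _ _ hs => hs ▸ h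

theorem ite (hK : 0 < K) (he : e.Evals S s v) (h : v ≠ 0 → Runs dec ω S c s K Q)
    (h' : v = 0 → Runs dec ω S c' s K Q) : Runs dec ω S (.ite e c c') s K Q := by
  obtain ⟨hfit, rfl⟩ := he
  have htest := hfit.cost_add_le.trans (Nat.le_mul_of_pos_left _ hK)
  by_cases hz : e.eval s = 0
  · obtain ⟨s', t, hx, ht, hq⟩ := h' hz
    refine ⟨s', _, .iteFalse e c c' s s' t hz hx, ?_, hq⟩
    simp only [Cmd.nodes, add_mul, mul_add]
    omega
  · obtain ⟨s', t, hx, ht, hq⟩ := h hz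
    refine ⟨s', _, .iteTrue e c c' s s' t hz hx, ?_, hq⟩
    simp only [Cmd.nodes, add_mul, mul_add]
    omega

theorem loop (I : ℕ → State → Prop) (N : ℕ) (hK : 0 < K) (h0 : I 0 s)
    (hstep : ∀ i < N, ∀ s', c.Frame s s' → I i s' →
      (∃ v ≠ 0, e.Evals S s' v) ∧ Runs dec ω S c s' K (I (i + 1)))
    (hend : ∀ s', c.Frame s s' → I N s' → e.Evals S s' 0) :
    Runs dec ω S (.loop e c) s ((N + 1) * K) (I N) := by
  suffices key : ∀ k i s', i + k = N → c.Frame s s' → I i s' →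
      Runs dec ω S (.loop e c) s' ((k + 1) * K) (I N) from key N 0 s (zero_add N) (.refl _ _) h0
  intro k
  induction k with
  | zero =>
    intro i s' hi hF hs
    obtain rfl : i = N := hi
    obtain ⟨hfit, hz⟩ := hend s' hF hs
    have htest := hfit.cost_add_le.trans (Nat.le_mul_of_pos_left _ hK)
    refine ⟨s', _, .loopDone e c s' hz, ?_, hs⟩
    rw [Cmd.nodes, zero_add, one_mul, add_mul, mul_add]
    omega
  | succ k ih =>
    intro i s' hi hF hs
    obtain ⟨⟨v, hv, hfit, rfl⟩, s₁, t, hx, ht, hq⟩ := hstep i (by omega) s' hF hs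
    obtain ⟨s₂, t', hx', ht', hq'⟩ := ih (i + 1) s₁ (by omega) (hF.trans hx.frame) hq
    have htest := hfit.cost_add_le.trans (Nat.le_mul_of_pos_left _ hK)
    refine ⟨s₂, _, .loopStep e c s' s₁ s₂ t t' hv hx hx', ?_, hq'⟩
    rw [Cmd.nodes] at ht' ⊢
    rw [add_one_mul (k + 1), add_mul, add_mul _ _ (stepTime S), mul_add K]
    rw [add_mul _ _ (stepTime S)] at ht'
    omega

end Runs

/-- The loop `for r = 0, …, bound - 1 do body`.  The bound is evaluated anew before each pass. -/
def Cmd.forUp (r : ℕ) (bound : Expr) (body : Cmd) : Cmd :=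
  .seq (.assign r (.lit 0)) (.loop (.bin .sub bound (.reg r))
    (.seq body (.assign r (.bin .add (.reg r) (.lit 1)))))

theorem Runs.forUp {m : ℕ} {dec : Cube m → Cube m} {ω : ℕ → Bool} {s : State} {S K r N : ℕ}
    {bound : Expr} {body : Cmd} (hK : 0 < K) (hr : body.assigns r = false) (I : ℕ → State → Prop)
    (hN : ∀ s', (Cmd.forUp r bound body).Frame s s' → bound.Evals S s' N)
    (h0 : I 0 (s.setReg r 0))
    (hstep : ∀ i < N, ∀ s', (Cmd.forUp r bound body).Frame s s' → s'.reg r = i → I i s' →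
      Runs dec ω S body s' K fun s'' => I (i + 1) (s''.setReg r (i + 1))) :
    Runs dec ω S (Cmd.forUp r bound body) s ((N + 1) * K) (I N) := by
  have hlt : N < 2 ^ S := by
    obtain ⟨hfit, rfl⟩ := hN s (.refl _ s)
    exact hfit.eval_lt
  have hinit : (Cmd.forUp r bound body).Frame s (s.setReg r 0) :=
    (Cmd.Frame.setReg s r 0 _).seq_left
  have hcounter : ∀ i ≤ N, ∀ s', (Cmd.forUp r bound body).Frame s s' → s'.reg r = i →
      (Expr.bin .sub bound (.reg r)).Evals S s' (N - i) := fun i hi s' hF hri =>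
    ⟨⟨(hN s' hF).1, by rw [Expr.Fits]; omega, trivial⟩, by
      rw [Expr.eval, (hN s' hF).2, Expr.eval, hri, Op.eval]⟩
  refine assign_seq (by positivity) ⟨Nat.two_pow_pos S, rfl⟩ ((loop (K := K)
    (fun i s' => s'.reg r = i ∧ I i s') N hK ⟨?_, h0⟩ ?_ ?_).mono le_rfl fun _ _ h => h.2)
  · rw [State.setReg_reg, if_pos rfl]
  · rintro i hi s' hF ⟨hri, hI⟩
    have hF' := hinit.trans hF.loop.seq_right
    refine ⟨⟨N - i, by omega, hcounter i hi.le s' hF' hri⟩, seq (hstep i hi s' hF' hri hI) ?_⟩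
    intro s₁ hF₁ hI₁
    have hri₁ : s₁.reg r = i := (hF₁.reg r hr).trans hri
    refine assign hK (v := i + 1) ⟨⟨?_, ?_, ?_⟩, ?_⟩ ⟨?_, hI₁⟩
    · rw [Expr.Fits]; omega
    · rw [Expr.Fits]; omega
    · simp only [Op.Fits, Expr.eval]; omega
    · simp only [Op.eval, Expr.eval, hri₁]
    · rw [State.setReg_reg, if_pos rfl]
  · rintro s' hF ⟨hri, -⟩
    simpa only [Nat.sub_self] using hcounter N le_rfl s' (hinit.trans hF.loop.seq_right) hri

end RAM

/-! ### The program -/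

namespace RAM.ClosestPair

open RAM.Expr RAM.Cmd

local infixl:65 "+ₑ" => Expr.bin Op.add
local infixl:65 "-ₑ" => Expr.bin Op.sub
local infixl:70 "*ₑ" => Expr.bin Op.mul
local infixl:70 "/ₑ" => Expr.bin Op.div
local infixl:70 "%ₑ" => Expr.bin Op.mod
local infixr:60 ";;" => Cmd.seq

local notation "rNum" => 0
local notation "rDim" => 1
local notation "rMin" => 2
local notation "rSecond" => 3
local notation "rSelect" => 4
local notation "rRep" => 5
local notation "rLeft" => 6
local notation "rRight" => 7
local notation "rRandom" => 8
local notation "rCoin" => 9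
local notation "rVec" => 10
local notation "rKey" => 11
local notation "rCoord" => 12
local notation "rDigits" => 13
local notation "rQuota" => 14
local notation "rProbe" => 15
local notation "rOther" => 16
local notation "rDist" => 17
local notation "rReps" => 18
local notation "rBit" => 19
local notation "rNumer" => 20
local notation "rDenom" => 21

/-- The bit number `c` of the input vector number `v`. -/
def bitAt (v c : Expr) : Expr := load (v *ₑ reg rDim +ₑ c)

/-- The address of the entry number `rProbe` of the bucket with number `rKey`.  Each bucket has
`n + 1` cells: an entry `i` is stored as `i + 1`, and a zero ends the bucket. -/
def slotAddr : Expr := reg rKey *ₑ (reg rNum +ₑ lit 1) +ₑ reg rProbe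

/-- Compute the Hamming distance of the vectors `rVec` and `rOther`. -/
def distLoop : Cmd :=
  assign rDist (lit 0) ;;
  forUp rCoord (reg rDim) (assign rDist (reg rDist +ₑ
    (bitAt (reg rVec) (reg rCoord) +ₑ bitAt (reg rOther) (reg rCoord)) %ₑ lit 2))

/-- Compare the vector `rVec` with one entry of its bucket. -/
def probeBody : Cmd :=
  assign rOther (load slotAddr -ₑ lit 1) ;;
  distLoop ;;
  ite (lit 1 -ₑ (reg rDist -ₑ reg rMin))
    (assign rLeft (reg rVec) ;; assign rRight (reg rOther)) skip ;;
  assign rProbe (reg rProbe +ₑ lit 1)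

/-- Compare the vector `rVec` with all entries of its bucket. -/
def probeLoop : Cmd := assign rProbe (lit 0) ;; loop (load slotAddr) probeBody

/-- Process one coordinate in the computation of the key; see `keyNum`. -/
def keyBody : Cmd :=
  ite (reg rQuota -ₑ reg rDigits %ₑ (reg rDim -ₑ reg rCoord))
    (assign rQuota (reg rQuota -ₑ lit 1) ;; assign rKey (lit 2 *ₑ reg rKey))
    (assign rKey (lit 2 *ₑ reg rKey +ₑ bitAt (reg rVec) (reg rDim -ₑ lit 1 -ₑ reg rCoord))) ;;
  assign rDigits (reg rDigits /ₑ (reg rDim -ₑ reg rCoord))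

/-- Compute the key of the vector `rVec`.  It starts with the number of the repetition, so that
every repetition finds its buckets empty; the shift by `1` keeps the buckets off the input. -/
def keyLoop : Cmd :=
  assign rKey (reg rRep +ₑ lit 1) ;; assign rDigits (reg rRandom) ;; assign rQuota (reg rSelect) ;;
  forUp rCoord (reg rDim) keyBody

/-- Compare the vector `rVec` with the entries of its bucket, and append it to the bucket. -/
def vecBody : Cmd := keyLoop ;; probeLoop ;; store slotAddr (reg rVec +ₑ lit 1)

/-- Toss a coin and append the outcome to the binary number `rRandom`. -/
def coinBody : Cmd := flip rBit ;; assign rRandom (lit 2 *ₑ reg rRandom +ₑ reg rBit)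

/-- Draw a random number with `m * m` bits. -/
def coinLoop : Cmd := assign rRandom (lit 0) ;; forUp rCoin (reg rDim *ₑ reg rDim) coinBody

/-- One repetition: choose a random set of coordinates and sort the vectors into buckets
according to the other coordinates. -/
def repBody : Cmd := coinLoop ;; forUp rVec (reg rNum) vecBody

/-- Compute the ratio of falling factorials whose inverse is the success probability of a
repetition. -/
def ratioLoop : Cmd :=
  assign rNumer (lit 1) ;; assign rDenom (lit 1) ;;
  forUp rCoord (reg rMin)
    (assign rNumer (reg rNumer *ₑ (reg rDim -ₑ reg rCoord)) ;;
      assign rDenom (reg rDenom *ₑ (reg rSelect -ₑ reg rCoord)))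

/-- Compute the number of selected coordinates and the number of repetitions. -/
def setup : Cmd :=
  assign rSelect (lit 2 *ₑ reg rSecond -ₑ lit 1) ;;
  ite (reg rSelect -ₑ reg rDim) (assign rSelect (reg rDim)) skip ;;
  ratioLoop ;;
  assign rReps ((reg rNumer /ₑ reg rDenom +ₑ lit 1) *ₑ (lit 4 *ₑ (reg rDim +ₑ lit 1)))

/-- Find the closest pair. -/
def program : Cmd :=
  setup ;; forUp rRep (reg rReps) repBody ;; assign rNum (reg rLeft) ;; assign rDim (reg rRight)

theorem program_oracleFree : program.OracleFree := by
  simp only [program, setup, ratioLoop, repBody, coinLoop, coinBody, vecBody, keyLoop, keyBody,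
    probeLoop, probeBody, distLoop, forUp, Cmd.OracleFree, and_self]

/-! ### Keys and buckets -/

/-- The key of a vector with bits `f`, with prefix `k`: in binary, `k` followed by the bits of `f`
from the coordinate `p - 1` down to `0`, those in `selection p u r` being replaced by `0`. -/
def keyNum (f : ℕ → Bool) : ℕ → ℕ → ℕ → ℕ → ℕ
  | 0, _, _, k => k
  | p + 1, u, r, k =>
    if r % (p + 1) < u then keyNum f p (u - 1) (r / (p + 1)) (2 * k)
    else keyNum f p u (r / (p + 1)) (2 * k + (f p).toNat)

theorem mul_two_pow_le_keyNum (f : ℕ → Bool) (p u r k : ℕ) : k * 2 ^ p ≤ keyNum f p u r k := by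
  induction p generalizing u r k with
  | zero => rw [keyNum, pow_zero, mul_one]
  | succ p ih =>
    have hk : k * 2 ^ (p + 1) = 2 * k * 2 ^ p := by ring
    rw [keyNum, hk]
    split_ifs
    · exact ih _ _ _
    · exact (Nat.mul_le_mul_right _ (Nat.le_add_right _ _)).trans (ih _ _ _)

theorem keyNum_lt (f : ℕ → Bool) (p u r k : ℕ) : keyNum f p u r k < (k + 1) * 2 ^ p := by
  induction p generalizing u r k with
  | zero => rw [keyNum, pow_zero, mul_one]; exact k.lt_succ_self
  | succ p ih =>
    have hk : (k + 1) * 2 ^ (p + 1) = (2 * k + 2) * 2 ^ p := by ring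
    have hbit := (f p).toNat_le
    rw [keyNum, hk]
    split_ifs
    · exact (ih _ _ _).trans_le (Nat.mul_le_mul_right _ (by omega))
    · exact (ih _ _ _).trans_le (Nat.mul_le_mul_right _ (by omega))

theorem keyNum_eq_iff {f g : ℕ → Bool} {p u r k k' : ℕ} :
    keyNum f p u r k = keyNum g p u r k' ↔ k = k' ∧ ∀ q < p, q ∉ selection p u r → f q = g q := by
  induction p generalizing u r k k' with
  | zero => simp only [keyNum, Nat.not_lt_zero, false_implies, implies_true, and_true]
  | succ p ih =>
    have hp : p ∉ selection p u (r / (p + 1)) := fun h =>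
      (Finset.mem_range.1 (selection_subset_range _ _ _ h)).false
    have hbit : 2 * k + (f p).toNat = 2 * k' + (g p).toNat ↔ k = k' ∧ f p = g p := by
      cases f p <;> cases g p <;> simp <;> omega
    rw [keyNum, keyNum, selection]
    split_ifs
    · rw [ih]
      grind
    · rw [ih, hbit]
      grind

/-- The content of the cell number `t` of a bucket with the entries `L`. -/
def slot (L : List ℕ) (t : ℕ) : ℕ := (L.map (· + 1)).getD t 0

theorem slot_of_lt {L : List ℕ} {t : ℕ} (h : t < L.length) : slot L t = L[t] + 1 := by
  simp [slot, h]

theorem slot_length (L : List ℕ) : slot L L.length = 0 := by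
  simp [slot]

theorem slot_le {L : List ℕ} {i : ℕ} (hL : ∀ j ∈ L, j < i) (t : ℕ) : slot L t ≤ i := by
  rcases lt_or_ge t L.length with ht | ht
  · exact slot_of_lt ht ▸ hL _ (List.getElem_mem ht)
  · simp [slot, ht]

theorem slot_append_singleton (L : List ℕ) (i t : ℕ) :
    slot (L ++ [i]) t = if t = L.length then i + 1 else slot L t := by
  grind [slot]

/-- The vectors with numbers below `i` that have key `κ`. -/
def bucket (key : ℕ → ℕ) (i κ : ℕ) : List ℕ := (List.range i).filter fun j => key j = κ

theorem mem_bucket {key : ℕ → ℕ} {i κ j : ℕ} : j ∈ bucket key i κ ↔ j < i ∧ key j = κ := by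
  simp [bucket]

theorem bucket_length_le (key : ℕ → ℕ) (i κ : ℕ) : (bucket key i κ).length ≤ i :=
  (List.length_filter_le _ _).trans (List.length_range).le

theorem bucket_succ (key : ℕ → ℕ) (i κ : ℕ) :
    bucket key (i + 1) κ = if key i = κ then bucket key i κ ++ [i] else bucket key i κ := by
  rw [bucket, List.range_succ, List.filter_append]
  split_ifs with h <;> simp [bucket, h]

theorem slot_bucket_succ (key : ℕ → ℕ) (i κ t : ℕ) :
    slot (bucket key (i + 1) κ) t =
      if κ = key i ∧ t = (bucket key i κ).length then i + 1 else slot (bucket key i κ) t := by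
  rw [bucket_succ]
  split_ifs <;> grind [slot_append_singleton]

theorem eq_of_mul_add_eq {n κ κ' t t' : ℕ} (ht : t ≤ n) (ht' : t' ≤ n)
    (h : κ * (n + 1) + t = κ' * (n + 1) + t') : κ = κ' ∧ t = t' := by
  have hdiv : ∀ k r, r ≤ n → (k * (n + 1) + r) / (n + 1) = k := fun k r hr => by
    rw [mul_comm, Nat.mul_add_div (by omega), Nat.div_eq_of_lt (by omega), add_zero]
  obtain rfl : κ = κ' := by rw [← hdiv κ t ht, h, hdiv κ' t' ht']
  exact ⟨rfl, by omega⟩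

/-! ### Execution of the program -/

section Loops

variable {m : ℕ} {dec : Cube m → Cube m} {ω : ℕ → Bool} {s s' : State} {S K : ℕ} {c : Cmd}
  {n M dmin R : ℕ} {x : ℕ → ℕ → Bool}

/-- The state holds an instance with `n` vectors of dimension `M`, whose bits are `x`, and with
minimum distance `dmin`. -/
structure HoldsInput (n M dmin : ℕ) (x : ℕ → ℕ → Bool) (s : State) : Prop where
  num : s.reg rNum = n
  dim : s.reg rDim = M
  min : s.reg rMin = dmin
  min_le : dmin ≤ M
  bit : ∀ i < n, ∀ p < M, s.mem (i * M + p) = (x i p).toNat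

/-- Numbers with `S` bits suffice for the addresses of the buckets of `R` repetitions. -/
structure Capacity (n M R S : ℕ) : Prop where
  two_le : 2 ≤ n
  reps_pos : 0 < R
  le : (R + 1) * 2 ^ M * (n + 1) ≤ 2 ^ S

/-- The first `M` bits of the vectors `i` and `j` differ in `dist M x i j` places. -/
def dist (M : ℕ) (x : ℕ → ℕ → Bool) (i j : ℕ) : ℕ := Nat.count (fun p => x i p ≠ x j p) M

/-- The candidates for the output are numbers of vectors, and if `p` holds, they form a pair
at distance at most `dmin`. -/
structure Candidates (n M dmin : ℕ) (x : ℕ → ℕ → Bool) (p : Prop) (s : State) : Prop where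
  left_lt : s.reg rLeft < n
  right_lt : s.reg rRight < n
  close : p → s.reg rLeft ≠ s.reg rRight ∧ dist M x (s.reg rLeft) (s.reg rRight) ≤ dmin

theorem HoldsInput.congr (h : HoldsInput n M dmin x s) (h0 : s'.reg rNum = s.reg rNum)
    (h1 : s'.reg rDim = s.reg rDim) (h2 : s'.reg rMin = s.reg rMin)
    (hmem : ∀ a < n * M, s'.mem a = s.mem a) : HoldsInput n M dmin x s' :=
  ⟨h0.trans h.num, h1.trans h.dim, h2.trans h.min, h.min_le, fun i hi p hp =>
    (hmem _ (by nlinarith)).trans (h.bit i hi p hp)⟩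

theorem HoldsInput.of_frame (h : HoldsInput n M dmin x s) (hF : c.Frame s s')
    (h0 : c.assigns rNum = false) (h1 : c.assigns rDim = false) (h2 : c.assigns rMin = false)
    (hmem : c.stores = false) : HoldsInput n M dmin x s' :=
  h.congr (hF.reg _ h0) (hF.reg _ h1) (hF.reg _ h2) fun a _ => congrFun (hF.mem hmem) a

theorem HoldsInput.setReg (h : HoldsInput n M dmin x s) {r : ℕ} (hr : rMin < r) (v : ℕ) :
    HoldsInput n M dmin x (s.setReg r v) :=
  h.of_frame (.setReg s r v (.lit v)) (beq_false_of_ne (by omega)) (beq_false_of_ne (by omega))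
    (beq_false_of_ne (by omega)) rfl

theorem Candidates.imp {p q : Prop} (h : Candidates n M dmin x p s) (hq : q → p)
    (hl : s'.reg rLeft = s.reg rLeft) (hr : s'.reg rRight = s.reg rRight) :
    Candidates n M dmin x q s' :=
  ⟨hl ▸ h.left_lt, hr ▸ h.right_lt, fun hp => hl ▸ hr ▸ h.close (hq hp)⟩

namespace Capacity

theorem mul_add_one_lt (h : Capacity n M R S) {κ t : ℕ} (hκ : κ < (R + 1) * 2 ^ M) (ht : t ≤ n) :
    κ * (n + 1) + t < 2 ^ S := by
  refine lt_of_lt_of_le ?_ ((Nat.mul_le_mul_right _ hκ).trans h.le)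
  rw [Nat.succ_mul]
  omega

theorem lt_two_pow (h : Capacity n M R S) {κ : ℕ} (hκ : κ < (R + 1) * 2 ^ M) : κ < 2 ^ S :=
  (Nat.le_mul_of_pos_right κ n.succ_pos).trans_lt (h.mul_add_one_lt hκ n.zero_le)

theorem mul_dim_add_lt (h : Capacity n M R S) {i p : ℕ} (hi : i < n) (hp : p ≤ M) :
    i * M + p < 2 ^ S := by
  have hM : M + 1 ≤ 2 ^ M := Nat.lt_two_pow_self
  have hR : 2 ^ M ≤ (R + 1) * 2 ^ M := Nat.le_mul_of_pos_left _ R.succ_pos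
  have := h.mul_add_one_lt (κ := M) (t := i) (by omega) hi.le
  nlinarith

theorem card_lt (h : Capacity n M R S) : n + 1 < 2 ^ S := by
  have hR : 2 ≤ (R + 1) * 2 ^ M := Nat.mul_le_mul (Nat.succ_le_succ h.reps_pos) Nat.one_le_two_pow
  have := h.mul_add_one_lt (κ := 1) (t := n) (by omega) le_rfl
  have := h.two_le
  omega

theorem dim_lt (h : Capacity n M R S) : M < 2 ^ S := by
  have := h.mul_dim_add_lt (i := 0) (by have := h.two_le; omega) le_rfl
  omega

end Capacity

theorem bitAt_evals (hC : Capacity n M R S) (hI : HoldsInput n M dmin x s) {v c : Expr} {i p : ℕ}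
    (hv : v.Evals S s i) (hc : c.Evals S s p) (hi : i < n) (hp : p < M) :
    (bitAt v c).Evals S s (x i p).toNat := by
  have haddr := hC.mul_dim_add_lt hi hp.le
  refine .load (.bin (.bin hv (.reg hI.dim hC.dim_lt) ?_) hc haddr) (hI.bit i hi p hp) ?_
  · exact (Nat.le_add_right _ _).trans_lt haddr
  · have := (x i p).toNat_le
    have := hC.card_lt
    omega

theorem slotAddr_evals (hC : Capacity n M R S) (hn : s.reg rNum = n) {κ t : ℕ}
    (hκ : s.reg rKey = κ) (ht : s.reg rProbe = t) (hκR : κ < (R + 1) * 2 ^ M) (htn : t ≤ n) :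
    slotAddr.Evals S s (κ * (n + 1) + t) := by
  have haddr := hC.mul_add_one_lt hκR htn
  have hnS := hC.card_lt
  refine .bin (.bin (.reg hκ (hC.lt_two_pow hκR)) (.bin (.reg hn (by omega)) (.lit (by omega)) ?_)
    ?_) (.reg ht (by omega)) haddr
  · exact hnS
  · exact (Nat.le_add_right _ _).trans_lt haddr

theorem distLoop_runs (hC : Capacity n M R S) (hI : HoldsInput n M dmin x s) {i j : ℕ}
    (hv : s.reg rVec = i) (ho : s.reg rOther = j) (hi : i < n) (hj : j < n) :
    Runs dec ω S distLoop s (M + 1) fun s' => s'.reg rDist = dist M x i j := by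
  have hnS := hC.card_lt
  have hMS := hC.dim_lt
  refine Runs.assign_seq M.succ_pos (.lit (by omega)) ((Runs.forUp one_pos rfl
    (fun p s' => s'.reg rDist = Nat.count (fun p => x i p ≠ x j p) p) ?_ ?_ ?_).mono
    (mul_one _).le fun _ _ h => h)
  · exact fun s' hF => .reg ((hF.reg rDim rfl).trans hI.dim) hMS
  · rfl
  intro p hp s' hF hpr hcount
  have hI' : HoldsInput n M dmin x s' :=
    (hI.setReg (by norm_num) 0).of_frame hF rfl rfl rfl rfl
  have hle := Nat.count_le (p := fun p => x i p ≠ x j p) (n := p)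
  have hbit : ((x i p).toNat + (x j p).toNat) % 2 = if x i p ≠ x j p then 1 else 0 := by
    cases x i p <;> cases x j p <;> rfl
  have hcoord : (reg rCoord).Evals S s' p := .reg hpr (by omega)
  have hbits := fun k => (x k p).toNat_le
  refine Runs.assign one_pos (.bin (.reg hcount (by omega)) (.bin (.bin
    (bitAt_evals hC hI' (.reg ((hF.reg rVec rfl).trans hv) (by omega)) hcoord hi hp)
    (bitAt_evals hC hI' (.reg ((hF.reg rOther rfl).trans ho) (by omega)) hcoord hj hp) ?_)
    (.lit (by omega)) trivial) ?_) ?_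
  · have := hbits i; have := hbits j
    simp only [Op.Fits]; omega
  · simp only [Op.eval, Op.Fits]; omega
  · simp only [Op.eval, hbit, Nat.count_succ]
    rfl

theorem probeBody_runs (hC : Capacity n M R S) (hI : HoldsInput n M dmin x s) {i j κ t : ℕ}
    {p : Prop} (hv : s.reg rVec = i) (hk : s.reg rKey = κ) (ht : s.reg rProbe = t) (hi : i < n)
    (hj : j < i) (hκ : κ < (R + 1) * 2 ^ M) (htn : t < n)
    (hslot : s.mem (κ * (n + 1) + t) = j + 1) (hcand : Candidates n M dmin x p s) :
    Runs dec ω S probeBody s (M + 1) fun s' =>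
      s'.reg rProbe = t + 1 ∧ Candidates n M dmin x (p ∨ dist M x i j ≤ dmin) s' := by
  have hnS := hC.card_lt
  have hdist : dist M x i j ≤ M := Nat.count_le _
  have hMS := hC.dim_lt
  have hmin := hI.min_le
  have hother : (load slotAddr -ₑ lit 1).Evals S s j :=
    .bin (.load (slotAddr_evals hC hI.num hk ht hκ htn.le) hslot (by omega)) (.lit (by omega))
      trivial
  refine Runs.assign_seq M.succ_pos hother (Runs.seq (distLoop_runs (j := j) hC
    (hI.setReg (by norm_num) j) hv rfl hi (by omega)) fun s₁ hF₁ hd₁ => ?_)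
  have hv₁ : s₁.reg rVec = i := (hF₁.reg _ rfl).trans hv
  have ho₁ : s₁.reg rOther = j := hF₁.reg _ rfl
  have ht₁ : s₁.reg rProbe = t := (hF₁.reg _ rfl).trans ht
  have hmin₁ : s₁.reg rMin = dmin := (hF₁.reg _ rfl).trans hI.min
  have hcand₁ : Candidates n M dmin x p s₁ :=
    hcand.imp id (hF₁.reg _ rfl) (hF₁.reg _ rfl)
  refine Runs.seq (Q := fun s' => Candidates n M dmin x (p ∨ dist M x i j ≤ dmin) s')
    (Runs.ite M.succ_pos (.bin (.lit (by omega)) (.bin (.reg hd₁ (by omega))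
      (.reg hmin₁ (by omega)) trivial) trivial) (fun hle => ?_) fun hgt => ?_) ?_
  · refine Runs.assign_seq M.succ_pos (.reg hv₁ (by omega)) (Runs.assign M.succ_pos
      (.reg ho₁ (by omega)) ⟨hi, hj.trans hi, fun _ => ⟨hj.ne', ?_⟩⟩)
    simp only [Op.eval] at hle
    change dist M x i j ≤ dmin
    omega
  · simp only [Op.eval] at hgt
    exact Runs.skip M.succ_pos (hcand₁.imp (fun h => h.resolve_right (by omega)) rfl rfl)
  · intro s₂ hF₂ hcand₂
    exact Runs.assign M.succ_pos (.bin (.reg ((hF₂.reg _ rfl).trans ht₁) (by omega))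
      (.lit (by omega)) (by simp only [Op.Fits]; omega)) ⟨rfl, hcand₂.imp id rfl rfl⟩

theorem probeLoop_runs (hC : Capacity n M R S) (hI : HoldsInput n M dmin x s) {i κ : ℕ}
    {L : List ℕ} {p : Prop} (hv : s.reg rVec = i) (hk : s.reg rKey = κ) (hi : i < n)
    (hL : ∀ j ∈ L, j < i) (hκ : κ < (R + 1) * 2 ^ M) (hlen : L.length ≤ n)
    (hslot : ∀ t ≤ L.length, s.mem (κ * (n + 1) + t) = slot L t)
    (hcand : Candidates n M dmin x p s) :
    Runs dec ω S probeLoop s ((L.length + 1) * (M + 1)) fun s' =>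
      s'.reg rProbe = L.length ∧
        Candidates n M dmin x (p ∨ ∃ j ∈ L, dist M x i j ≤ dmin) s' := by
  have hnS := hC.card_lt
  have haddr : ∀ s', probeBody.Frame (s.setReg rProbe 0) s' → ∀ t ≤ L.length, s'.reg rProbe = t →
      (load slotAddr).Evals S s' (slot L t) := fun s' hF t ht hp =>
    .load (slotAddr_evals hC ((hF.reg _ rfl).trans hI.num) ((hF.reg _ rfl).trans hk) hp hκ
      (ht.trans hlen)) (hF.mem rfl ▸ hslot t ht) ((slot_le hL t).trans_lt (by omega))
  refine Runs.assign_seq (by positivity) (.lit (by omega)) ((Runs.loop (fun t s' =>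
    s'.reg rProbe = t ∧ Candidates n M dmin x (p ∨ ∃ j ∈ L.take t, dist M x i j ≤ dmin) s')
    L.length M.succ_pos ?_ ?_ ?_).mono le_rfl ?_)
  · exact ⟨rfl, hcand.imp (by simp) rfl rfl⟩
  · rintro t ht s' hF ⟨hp, hc⟩
    have hslot' := slot_of_lt ht
    refine ⟨⟨slot L t, by omega, haddr s' hF t ht.le hp⟩, ?_⟩
    refine (probeBody_runs hC ((hI.setReg (by norm_num) 0).of_frame hF rfl rfl rfl rfl)
      ((hF.reg _ rfl).trans hv) ((hF.reg _ rfl).trans hk) hp hi (hL _ (List.getElem_mem ht)) hκ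
      (by omega) (hF.mem rfl ▸ (hslot t ht.le).trans hslot') hc).mono le_rfl ?_
    rintro s'' - ⟨hp', hc'⟩
    refine ⟨hp', hc'.imp ?_ rfl rfl⟩
    simp only [List.take_succ_eq_append_getElem ht, List.mem_append, List.mem_singleton,
      or_and_right, exists_or, exists_eq_left, or_assoc, imp_self]
  · rintro s' hF ⟨hp, -⟩
    exact slot_length L ▸ haddr s' hF _ le_rfl hp
  · rintro s' - ⟨hp, hc⟩
    exact ⟨hp, hc.imp (by simp) rfl rfl⟩

theorem Capacity.two_mul_prefix_add_one_lt (hC : Capacity n M R S) {f : ℕ → Bool} {p u r k : ℕ}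
    (hκ : keyNum f (p + 1) u r k < (R + 1) * 2 ^ M) : 2 * k + 1 < 2 ^ S := by
  have hdouble : 2 * k ≤ keyNum f (p + 1) u r k := by
    refine le_trans ?_ (mul_two_pow_le_keyNum f (p + 1) u r k)
    rw [mul_comm]
    exact Nat.mul_le_mul_left k (Nat.le_self_pow p.succ_ne_zero 2)
  have hpad : keyNum f (p + 1) u r k ≤ keyNum f (p + 1) u r k * (n + 1) :=
    Nat.le_mul_of_pos_right _ n.succ_pos
  have := hC.mul_add_one_lt hκ hC.two_le
  omega

theorem keyBody_runs (hC : Capacity n M R S) (hI : HoldsInput n M dmin x s) {i p u r k : ℕ}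
    (hv : s.reg rVec = i) (hi : i < n) (hp : p < M) (hc : s.reg rCoord = M - (p + 1))
    (hq : s.reg rQuota = u) (hd : s.reg rDigits = r) (hk : s.reg rKey = k) (hu : u < 2 ^ S)
    (hr : r < 2 ^ S) (hκ : keyNum (x i) (p + 1) u r k < (R + 1) * 2 ^ M) :
    Runs dec ω S keyBody s 1 fun s' => s'.reg rQuota ≤ u ∧ s'.reg rDigits ≤ r ∧
      keyNum (x i) p (s'.reg rQuota) (s'.reg rDigits) (s'.reg rKey) =
        keyNum (x i) (p + 1) u r k := by
  have hnS := hC.card_lt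
  have hn := hC.two_le
  have hMS := hC.dim_lt
  have hkS := hC.two_mul_prefix_add_one_lt hκ
  have hbase : ∀ s', keyBody.Frame s s' → (reg rDim -ₑ reg rCoord).Evals S s' (p + 1) := by
    intro s' hF
    have hsub : M - (M - (p + 1)) = p + 1 := by omega
    exact hsub ▸ .bin (.reg ((hF.reg _ rfl).trans hI.dim) hMS)
      (.reg ((hF.reg _ rfl).trans hc) (by omega)) trivial
  have htwo : (lit 2).Evals S s 2 := .lit (by omega)
  refine Runs.seq (Q := fun s' => s'.reg rQuota ≤ u ∧
      keyNum (x i) p (s'.reg rQuota) (r / (p + 1)) (s'.reg rKey) = keyNum (x i) (p + 1) u r k)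
    (Runs.ite one_pos (.bin (.reg hq hu) (.bin (.reg hd hr) (hbase s (.refl _ _)) trivial) trivial)
      (fun hlt => ?_) fun hge => ?_) ?_
  · simp only [Op.eval] at hlt
    refine Runs.assign_seq one_pos (.bin (.reg hq hu) (.lit (by omega)) trivial)
      (Runs.assign one_pos (.bin (.lit (by omega)) (.reg hk (by omega))
        (by simp only [Op.Fits]; omega)) ⟨Nat.sub_le u 1, ?_⟩)
    rw [keyNum, if_pos (by omega)]
    rfl
  · simp only [Op.eval] at hge
    have hbit := (x i p).toNat_le
    have hcoord : (reg rDim -ₑ lit 1 -ₑ reg rCoord).Evals S s p := by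
      have hsub : M - 1 - (M - (p + 1)) = p := by omega
      exact hsub ▸ .bin (.bin (.reg hI.dim hMS) (.lit (by omega)) trivial) (.reg hc (by omega))
        trivial
    refine Runs.assign one_pos (.bin (.bin htwo (.reg hk (by omega))
      (by simp only [Op.Fits]; omega)) (bitAt_evals hC hI (.reg hv (by omega)) hcoord hi hp)
        (by simp only [Op.Fits, Op.eval]; omega)) ⟨hq.le, ?_⟩
    rw [keyNum, if_neg (by omega), ← hq]
    rfl
  · rintro s₁ hF ⟨hq₁, hkey⟩
    refine Runs.assign one_pos (.bin (.reg ((hF.reg _ rfl).trans hd) hr)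
      (hbase s₁ hF.seq_left) trivial) ⟨hq₁, Nat.div_le_self _ _, hkey⟩

theorem keyLoop_runs (hC : Capacity n M R S) (hI : HoldsInput n M dmin x s) {i ρ u r : ℕ}
    (hv : s.reg rVec = i) (hi : i < n) (hρ : s.reg rRep = ρ) (hρR : ρ < R)
    (hu : s.reg rSelect = u) (huS : u < 2 ^ S) (hr : s.reg rRandom = r) (hrS : r < 2 ^ S) :
    Runs dec ω S keyLoop s (M + 1) fun s' => s'.reg rKey = keyNum (x i) M u r (ρ + 1) := by
  have hκ : keyNum (x i) M u r (ρ + 1) < (R + 1) * 2 ^ M :=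
    (keyNum_lt (x i) M u r (ρ + 1)).trans_le (Nat.mul_le_mul_right _ (by omega))
  have hρS : ρ + 1 < 2 ^ S := hC.lt_two_pow
    ((Nat.succ_lt_succ hρR).trans_le (Nat.le_mul_of_pos_right _ (Nat.two_pow_pos M)))
  have hn := hC.card_lt
  refine Runs.assign_seq M.succ_pos (.bin (.reg hρ (by omega)) (.lit (by omega)) hρS)
    (Runs.assign_seq M.succ_pos (.reg hr hrS) (Runs.assign_seq M.succ_pos (.reg hu huS) ?_))
  have hI' := ((hI.setReg (r := rKey) (by norm_num) (ρ + 1)).setReg (r := rDigits)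
    (by norm_num) r).setReg (r := rQuota) (by norm_num) u
  refine ((Runs.forUp one_pos rfl (fun t s' => s'.reg rQuota ≤ u ∧ s'.reg rDigits ≤ r ∧
    keyNum (x i) (M - t) (s'.reg rQuota) (s'.reg rDigits) (s'.reg rKey) =
      keyNum (x i) M u r (ρ + 1)) ?_ ⟨le_rfl, le_rfl, rfl⟩ ?_).mono (mul_one _).le ?_)
  · exact fun s' hF => .reg ((hF.reg rDim rfl).trans hI.dim) hC.dim_lt
  · rintro t ht s' hF hc ⟨hq, hd, hkey⟩
    obtain ⟨p, hp⟩ : ∃ p, M - t = p + 1 := ⟨M - t - 1, by omega⟩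
    rw [hp] at hkey
    refine (keyBody_runs hC (hI'.of_frame hF rfl rfl rfl rfl) ((hF.reg _ rfl).trans hv) hi
      (p := p) (by omega) (by omega) rfl rfl rfl (by omega) (by omega)
      (hkey ▸ hκ)).mono le_rfl ?_
    rintro s'' - ⟨hq', hd', hkey'⟩
    obtain rfl : p = M - (t + 1) := by omega
    exact ⟨hq'.trans hq, hd'.trans hd, hkey'.trans hkey⟩
  · rintro s' - ⟨-, -, hkey⟩
    rwa [Nat.sub_self, keyNum] at hkey

/-- The buckets of the keys with prefix `k` contain the vectors with numbers below `i`. -/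
def HoldsBuckets (n M k : ℕ) (key : ℕ → ℕ) (i : ℕ) (s : State) : Prop :=
  ∀ κ, k * 2 ^ M ≤ κ → κ < (k + 1) * 2 ^ M → ∀ t ≤ n,
    s.mem (κ * (n + 1) + t) = slot (bucket key i κ) t

/-- The states agree outside the buckets of the keys with prefix `k`. -/
def AgreeOffBuckets (n M k : ℕ) (s s' : State) : Prop :=
  ∀ a, a < k * 2 ^ M * (n + 1) ∨ (k + 1) * 2 ^ M * (n + 1) ≤ a → s'.mem a = s.mem a

theorem HoldsBuckets.store {k i κ : ℕ} {key : ℕ → ℕ} (h : HoldsBuckets n M k key i s)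
    (hκ : key i = κ) (hi : i ≤ n) : HoldsBuckets n M k key (i + 1)
      (s.setMem (κ * (n + 1) + (bucket key i κ).length) (i + 1)) := by
  subst hκ
  intro κ hle hlt t ht
  have hlen := (bucket_length_le key i (key i)).trans hi
  rw [State.setMem_mem, slot_bucket_succ, h κ hle hlt t ht]
  by_cases hcell : κ = key i ∧ t = (bucket key i κ).length
  · rw [if_pos hcell, if_pos (by rw [← hcell.1, ← hcell.2])]
  · rw [if_neg hcell, if_neg fun heq => hcell ?_]
    obtain ⟨rfl, rfl⟩ := eq_of_mul_add_eq ht hlen heq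
    exact ⟨rfl, rfl⟩

theorem AgreeOffBuckets.setMem {k κ t : ℕ} (hle : k * 2 ^ M ≤ κ) (hlt : κ < (k + 1) * 2 ^ M)
    (ht : t ≤ n) (v : ℕ) : AgreeOffBuckets n M k s (s.setMem (κ * (n + 1) + t) v) := by
  intro a ha
  have hlow : k * 2 ^ M * (n + 1) ≤ κ * (n + 1) := Nat.mul_le_mul_right _ hle
  have hhigh : κ * (n + 1) + (n + 1) ≤ (k + 1) * 2 ^ M * (n + 1) :=
    (Nat.succ_mul κ (n + 1)).symm.trans_le (Nat.mul_le_mul_right _ hlt)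
  rw [State.setMem_mem, if_neg (by omega)]

theorem vecBody_runs (hC : Capacity n M R S) (hI : HoldsInput n M dmin x s) {i ρ u r B : ℕ}
    {key : ℕ → ℕ} {p : Prop} (hv : s.reg rVec = i) (hi : i < n) (hρ : s.reg rRep = ρ)
    (hρR : ρ < R) (hu : s.reg rSelect = u) (huS : u < 2 ^ S) (hr : s.reg rRandom = r)
    (hrS : r < 2 ^ S) (hkey : key i = keyNum (x i) M u r (ρ + 1))
    (hB : (bucket key i (key i)).length ≤ B) (hbuckets : HoldsBuckets n M (ρ + 1) key i s)
    (hcand : Candidates n M dmin x p s) :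
    Runs dec ω S vecBody s ((B + 1) * (M + 1)) fun s' =>
      HoldsBuckets n M (ρ + 1) key (i + 1) s' ∧ AgreeOffBuckets n M (ρ + 1) s s' ∧
        Candidates n M dmin x (p ∨ ∃ j < i, key j = key i ∧ dist M x i j ≤ dmin) s' := by
  have hle : (ρ + 1) * 2 ^ M ≤ key i := hkey ▸ mul_two_pow_le_keyNum _ _ _ _ _
  have hlt : key i < (ρ + 1 + 1) * 2 ^ M := hkey ▸ keyNum_lt _ _ _ _ _
  have hltR : key i < (R + 1) * 2 ^ M := hlt.trans_le (Nat.mul_le_mul_right _ (by omega))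
  have hlen := (bucket_length_le key i (key i)).trans hi.le
  have hnS := hC.card_lt
  have hK : M + 1 ≤ (B + 1) * (M + 1) := Nat.le_mul_of_pos_left _ B.succ_pos
  refine Runs.seq ((keyLoop_runs hC hI hv hi hρ hρR hu huS hr hrS).mono hK fun _ _ h => h) ?_
  intro s₁ hF₁ hkey₁
  rw [← hkey] at hkey₁
  have hv₁ : s₁.reg rVec = i := (hF₁.reg _ rfl).trans hv
  have hI₁ := hI.of_frame hF₁ rfl rfl rfl rfl
  have hmem₁ : s₁.mem = s.mem := hF₁.mem rfl
  refine Runs.seq ((probeLoop_runs hC hI₁ hv₁ hkey₁ hi (fun j hj => (mem_bucket.1 hj).1)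
    hltR hlen (fun t ht => hmem₁ ▸ hbuckets _ hle hlt t (ht.trans hlen))
    (hcand.imp id (hF₁.reg _ rfl) (hF₁.reg _ rfl))).mono
    (Nat.mul_le_mul_right _ (Nat.succ_le_succ hB)) fun _ _ h => h) ?_
  rintro s₂ hF₂ ⟨hprobe, hcand₂⟩
  have hmem₂ : s₂.mem = s.mem := (hF₂.mem rfl).trans hmem₁
  have hkey₂ : s₂.reg rKey = key i := (hF₂.reg _ rfl).trans hkey₁
  refine Runs.store (by positivity) (slotAddr_evals hC ((hF₂.reg _ rfl).trans hI₁.num) hkey₂ hprobe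
    hltR hlen) (.bin (.reg ((hF₂.reg _ rfl).trans hv₁) (by omega)) (.lit (by omega))
    (by simp only [Op.Fits]; omega)) ⟨?_, ?_, hcand₂.imp ?_ rfl rfl⟩
  · exact HoldsBuckets.store (fun κ h h' t ht => hmem₂ ▸ hbuckets κ h h' t ht) rfl hi.le
  · exact fun a ha => (AgreeOffBuckets.setMem hle hlt hlen _ a ha).trans (congrFun hmem₂ a)
  · simp only [mem_bucket, and_assoc, imp_self]

theorem vecLoop_runs (hC : Capacity n M R S) (hI : HoldsInput n M dmin x s) {ρ u r B : ℕ}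
    {key : ℕ → ℕ} {p : Prop} (hρ : s.reg rRep = ρ) (hρR : ρ < R) (hu : s.reg rSelect = u)
    (huS : u < 2 ^ S) (hr : s.reg rRandom = r) (hrS : r < 2 ^ S)
    (hkey : ∀ i, key i = keyNum (x i) M u r (ρ + 1))
    (hB : ∀ i < n, (bucket key i (key i)).length ≤ B)
    (hzero : HoldsBuckets n M (ρ + 1) key 0 s) (hcand : Candidates n M dmin x p s) :
    Runs dec ω S (forUp rVec (reg rNum) vecBody) s ((n + 1) * ((B + 1) * (M + 1))) fun s' =>
      AgreeOffBuckets n M (ρ + 1) s s' ∧ Candidates n M dmin x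
        (p ∨ ∃ i < n, ∃ j < i, key j = key i ∧ dist M x i j ≤ dmin) s' := by
  have hnS := hC.card_lt
  have hinput : n * M ≤ (ρ + 1) * 2 ^ M * (n + 1) := by
    have hM : M ≤ (ρ + 1) * 2 ^ M :=
      Nat.lt_two_pow_self.le.trans (Nat.le_mul_of_pos_left _ ρ.succ_pos)
    exact (mul_comm n M).trans_le (Nat.mul_le_mul hM n.le_succ)
  refine (Runs.forUp (by positivity) rfl (fun i s' => HoldsBuckets n M (ρ + 1) key i s' ∧
    AgreeOffBuckets n M (ρ + 1) s s' ∧ Candidates n M dmin x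
      (p ∨ ∃ i' < i, ∃ j < i', key j = key i' ∧ dist M x i' j ≤ dmin) s') ?_
      ⟨hzero, fun _ _ => rfl, hcand.imp (by simp) rfl rfl⟩ ?_).mono le_rfl fun _ _ h => h.2
  · exact fun s' hF => .reg ((hF.reg rNum rfl).trans hI.num) (by omega)
  · rintro i hi s' hF hv ⟨hbuckets, hoff, hc⟩
    refine (vecBody_runs hC (hI.congr (hF.reg _ rfl) (hF.reg _ rfl) (hF.reg _ rfl)
      fun a ha => hoff a (Or.inl (by omega))) hv hi ((hF.reg _ rfl).trans hρ) hρR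
      ((hF.reg _ rfl).trans hu) huS ((hF.reg _ rfl).trans hr) hrS (hkey i) (hB i hi) hbuckets
      hc).mono le_rfl ?_
    rintro s'' - ⟨hbuckets', hoff', hc'⟩
    refine ⟨hbuckets', fun a ha => (hoff' a ha).trans (hoff a ha), hc'.imp ?_ rfl rfl⟩
    rw [or_assoc]
    refine Or.imp_right ?_
    rintro ⟨i', hi', h⟩
    rcases Nat.lt_succ_iff_lt_or_eq.1 hi' with hlt | rfl
    exacts [Or.inl ⟨i', hlt, h⟩, Or.inr h]

theorem coinBody_runs (hS : 2 < 2 ^ S) {v : ℕ} (hv : s.reg rRandom = v)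
    (hlt : 2 * v + (ω s.coins).toNat < 2 ^ S) :
    Runs dec ω S coinBody s 1 fun s' =>
      s'.reg rRandom = 2 * v + (ω s.coins).toNat ∧ s'.coins = s.coins + 1 := by
  refine Runs.seq (Q := (· = { s.setReg rBit (ω s.coins).toNat with coins := s.coins + 1 }))
    (Runs.flip one_pos rfl) ?_
  rintro s₁ - rfl
  have hdouble : 2 * v < 2 ^ S := (Nat.le_add_right _ _).trans_lt hlt
  exact Runs.assign one_pos (.bin (.bin (.lit hS) (.reg hv (by omega)) hdouble)
    (.reg (v := (ω s.coins).toNat) rfl (by omega)) hlt) ⟨rfl, rfl⟩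

theorem coinLoop_runs (hM : s.reg rDim = M) (hMS : M < 2 ^ S) (hS : 2 < 2 ^ S)
    (hMM : M * M ≤ S) :
    Runs dec ω S coinLoop s (M * M + 1) fun s' =>
      s'.reg rRandom = coinNum ω s.coins (M * M) ∧ s'.coins = s.coins + M * M := by
  refine Runs.assign_seq (by positivity) (.lit S.two_pow_pos) ((Runs.forUp (N := M * M)
    (s := s.setReg rRandom 0) one_pos rfl
    (fun i s' => s'.reg rRandom = coinNum ω s.coins i ∧ s'.coins = s.coins + i) ?_
    ⟨rfl, rfl⟩ ?_).mono (mul_one _).le fun _ _ h => h)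
  · intro s' hF
    have hdim : (reg rDim).Evals S s' M := .reg ((hF.reg _ rfl).trans hM) hMS
    exact .bin hdim hdim (hMM.trans_lt Nat.lt_two_pow_self)
  · rintro i hi s' - - ⟨hr, hc⟩
    have hbound : 2 * coinNum ω s.coins i + (ω s'.coins).toNat < 2 ^ S :=
      hc ▸ (coinNum_lt ω s.coins (i + 1)).trans_le (Nat.pow_le_pow_right two_pos (by omega))
    refine (coinBody_runs hS hr hbound).mono le_rfl ?_
    rintro s'' - ⟨hr', hc'⟩
    exact ⟨hr'.trans (by rw [hc]; rfl), hc'.trans (by rw [hc]; rfl)⟩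

/-- With the random number `r`, two vectors at distance at most `dmin` get into the same bucket. -/
def Collides (n M dmin : ℕ) (x : ℕ → ℕ → Bool) (u r : ℕ) : Prop :=
  ∃ i < n, ∃ j < i, (∀ q < M, q ∉ selection M u r → x j q = x i q) ∧ dist M x i j ≤ dmin

theorem repBody_runs (hC : Capacity n M R S) (hI : HoldsInput n M dmin x s) {ρ u B : ℕ}
    {p : Prop} (hMM : M * M ≤ S) (hρ : s.reg rRep = ρ) (hρR : ρ < R) (hu : s.reg rSelect = u)
    (huS : u < 2 ^ S)
    (hB : ∀ r, ∀ i < n, (bucket (fun j => keyNum (x j) M u r (ρ + 1)) i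
      (keyNum (x i) M u r (ρ + 1))).length ≤ B)
    (hzero : ∀ a, (ρ + 1) * 2 ^ M * (n + 1) ≤ a → s.mem a = 0)
    (hcand : Candidates n M dmin x p s) :
    Runs dec ω S repBody s (M * M + 1 + (n + 1) * ((B + 1) * (M + 1))) fun s' =>
      s'.coins = s.coins + M * M ∧ AgreeOffBuckets n M (ρ + 1) s s' ∧
        Candidates n M dmin x (p ∨ Collides n M dmin x u (coinNum ω s.coins (M * M))) s' := by
  have hS : 2 < 2 ^ S := (Nat.lt_succ_of_le hC.two_le).trans hC.card_lt
  have hrS : coinNum ω s.coins (M * M) < 2 ^ S :=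
    (coinNum_lt _ _ _).trans_le (Nat.pow_le_pow_right two_pos hMM)
  refine Runs.seq ((coinLoop_runs hI.dim hC.dim_lt hS hMM).mono (Nat.le_add_right _ _)
    fun _ _ h => h) ?_
  rintro s₁ hF₁ ⟨hr₁, hc₁⟩
  have hmem₁ : s₁.mem = s.mem := hF₁.mem rfl
  have hempty : HoldsBuckets n M (ρ + 1)
      (fun j => keyNum (x j) M u (coinNum ω s.coins (M * M)) (ρ + 1)) 0 s₁ := fun κ hκ _ t _ =>
    hmem₁ ▸ hzero _ ((Nat.mul_le_mul_right _ hκ).trans (Nat.le_add_right _ _))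
  refine (vecLoop_runs hC (hI.of_frame hF₁ rfl rfl rfl rfl) ((hF₁.reg _ rfl).trans hρ) hρR
    ((hF₁.reg _ rfl).trans hu) huS hr₁ hrS (fun _ => rfl) (hB _) hempty
    (hcand.imp id (hF₁.reg _ rfl) (hF₁.reg _ rfl))).mono (Nat.le_add_left _ _) ?_
  rintro s₂ hF₂ ⟨hoff, hc⟩
  refine ⟨(hF₂.coins rfl).trans hc₁, fun a ha => (hoff a ha).trans (congrFun hmem₁ a),
    hc.imp (Or.imp_right ?_) rfl rfl⟩
  rintro ⟨i, hi, j, hj, hagree, hdist⟩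
  exact ⟨i, hi, j, hj, keyNum_eq_iff.2 ⟨rfl, hagree⟩, hdist⟩

theorem repLoop_runs (hC : Capacity n M R S) (hI : HoldsInput n M dmin x s) {u B : ℕ}
    (hMM : M * M ≤ S) (hR : s.reg rReps = R) (hu : s.reg rSelect = u) (huS : u < 2 ^ S)
    (hB : ∀ r ρ, ∀ i < n, (bucket (fun j => keyNum (x j) M u r ρ) i
      (keyNum (x i) M u r ρ)).length ≤ B)
    (hcoins : s.coins = 0) (hzero : ∀ a, n * M ≤ a → s.mem a = 0)
    (hcand : Candidates n M dmin x False s) :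
    Runs dec ω S (forUp rRep (reg rReps) repBody) s
      ((R + 1) * (M * M + 1 + (n + 1) * ((B + 1) * (M + 1)))) fun s' =>
        Candidates n M dmin x
          (∃ ρ < R, Collides n M dmin x u (coinNum ω (ρ * (M * M)) (M * M))) s' := by
  have hinput : ∀ ρ, n * M ≤ (ρ + 1) * 2 ^ M * (n + 1) := fun ρ => by
    have hM : M ≤ (ρ + 1) * 2 ^ M :=
      Nat.lt_two_pow_self.le.trans (Nat.le_mul_of_pos_left _ ρ.succ_pos)
    exact (mul_comm n M).trans_le (Nat.mul_le_mul hM n.le_succ)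
  have hRS : R < 2 ^ S := hC.lt_two_pow
    (R.lt_succ_self.trans_le (Nat.le_mul_of_pos_right _ (Nat.two_pow_pos M)))
  refine (Runs.forUp (by positivity) rfl (fun ρ s' => s'.coins = ρ * (M * M) ∧
    (∀ a < n * M, s'.mem a = s.mem a) ∧
    (∀ a, (ρ + 1) * 2 ^ M * (n + 1) ≤ a → s'.mem a = 0) ∧ Candidates n M dmin x
      (∃ ρ' < ρ, Collides n M dmin x u (coinNum ω (ρ' * (M * M)) (M * M))) s') ?_ ?_ ?_).mono
    le_rfl fun _ _ h => h.2.2.2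
  · exact fun s' hF => .reg ((hF.reg rReps rfl).trans hR) hRS
  · exact ⟨hcoins.trans (zero_mul _).symm, fun _ _ => rfl,
      fun a ha => hzero a ((hinput 0).trans ha), hcand.imp (by simp) rfl rfl⟩
  · rintro ρ hρ s' hF hρ' ⟨hcoins', hkept, hzero', hc⟩
    refine (repBody_runs hC (hI.congr (hF.reg _ rfl) (hF.reg _ rfl) (hF.reg _ rfl) hkept) hMM hρ'
      hρ ((hF.reg _ rfl).trans hu) huS (fun r => hB r _) hzero' hc).mono le_rfl ?_
    rintro s'' - ⟨hcoins'', hoff, hc'⟩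
    refine ⟨hcoins''.trans ?_, fun a ha => (hoff a (Or.inl (ha.trans_le (hinput ρ)))).trans
      (hkept a ha), fun a ha => (hoff a (Or.inr ha)).trans (hzero' a ((Nat.mul_le_mul_right _
      (Nat.mul_le_mul_right _ (Nat.le_succ _))).trans ha)), hc'.imp ?_ rfl rfl⟩
    · rw [hcoins', Nat.succ_mul]
    · rintro ⟨ρ₀, hρ₀, h⟩
      rcases Nat.lt_succ_iff_lt_or_eq.1 hρ₀ with hlt | rfl
      exacts [Or.inl ⟨ρ₀, hlt, h⟩, Or.inr (hcoins' ▸ h)]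

theorem descFactorial_le_two_pow (n k : ℕ) : n.descFactorial k ≤ 2 ^ (n * k) :=
  calc n.descFactorial k ≤ n ^ k := Nat.descFactorial_le_pow n k
    _ ≤ (2 ^ n) ^ k := Nat.pow_le_pow_left Nat.lt_two_pow_self.le k
    _ = 2 ^ (n * k) := (pow_mul 2 n k).symm

theorem descFactorial_lt_two_pow {u k : ℕ} (hu : u ≤ M) (hk : k ≤ M) (hS : M * M < S) :
    u.descFactorial k < 2 ^ S :=
  (descFactorial_le_two_pow u k).trans_lt
    (Nat.pow_lt_pow_right one_lt_two ((Nat.mul_le_mul hu hk).trans_lt hS))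

theorem ratioLoop_runs (hM : s.reg rDim = M) (hmin : s.reg rMin = dmin) {u : ℕ}
    (hu : s.reg rSelect = u) (huM : u ≤ M) (hd : dmin ≤ M) (hMM : M * M < S) :
    Runs dec ω S ratioLoop s (dmin + 1) fun s' =>
      s'.reg rNumer = M.descFactorial dmin ∧ s'.reg rDenom = u.descFactorial dmin := by
  have hMS : M < 2 ^ S := (Nat.le_mul_self M).trans_lt (hMM.trans Nat.lt_two_pow_self)
  have hone : 1 < 2 ^ S := Nat.one_lt_two_pow (by omega)
  refine Runs.assign_seq (by positivity) (.lit hone) (Runs.assign_seq (by positivity) (.lit hone)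
    ((Runs.forUp one_pos rfl (fun k s' => s'.reg rNumer = M.descFactorial k ∧
      s'.reg rDenom = u.descFactorial k) ?_ ⟨rfl, rfl⟩ ?_).mono (mul_one _).le fun _ _ h => h))
  · exact fun s' hF => .reg ((hF.reg _ rfl).trans hmin) (by omega)
  · rintro k hk s' hF hk' ⟨hnumer, hdenom⟩
    have hbound : ∀ v ≤ M, v.descFactorial k * (v - k) < 2 ^ S := fun v hv => by
      rw [mul_comm, ← Nat.descFactorial_succ]
      exact descFactorial_lt_two_pow hv (by omega) hMM
    have hfactor : ∀ v ≤ M, v.descFactorial k < 2 ^ S := fun v hv =>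
      descFactorial_lt_two_pow hv (by omega) hMM
    refine Runs.assign_seq one_pos (.bin (.reg hnumer (hfactor M le_rfl)) (.bin
      (.reg ((hF.reg _ rfl).trans hM) hMS) (.reg hk' (by omega)) trivial) (hbound M le_rfl))
      (Runs.assign one_pos (.bin (.reg hdenom (hfactor u huM)) (.bin
      (.reg ((hF.reg _ rfl).trans hu) (by omega)) (.reg hk' (by omega)) trivial)
      (hbound u huM)) ⟨?_, ?_⟩)
    · rw [Nat.descFactorial_succ, mul_comm]; rfl
    · rw [Nat.descFactorial_succ, mul_comm]; rfl

/-- The number of selected coordinates. -/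
def selectCount (m d2 : ℕ) : ℕ := min m (2 * d2 - 1)

/-- The number of repetitions. -/
def repCount (m dmin d2 : ℕ) : ℕ :=
  (m.descFactorial dmin / (selectCount m d2).descFactorial dmin + 1) * (4 * (m + 1))

theorem setup_runs (hM : s.reg rDim = M) (hmin : s.reg rMin = dmin) {d2 : ℕ}
    (hd2 : s.reg rSecond = d2) (hd : dmin ≤ M) (hd2M : d2 ≤ M) (hMM : M * M < S)
    (hR : repCount M dmin d2 < 2 ^ S) :
    Runs dec ω S setup s (dmin + 1) fun s' =>
      s'.reg rSelect = selectCount M d2 ∧ s'.reg rReps = repCount M dmin d2 := by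
  have hdim : 4 * (M + 1) < 2 ^ S := (Nat.le_mul_of_pos_left _ (Nat.succ_pos _)).trans_lt hR
  have hratio : M.descFactorial dmin / (selectCount M d2).descFactorial dmin + 1 < 2 ^ S :=
    (Nat.le_mul_of_pos_right _ (by omega)).trans_lt hR
  have huM : selectCount M d2 ≤ M := min_le_left _ _
  refine Runs.assign_seq (by positivity) (.bin (.bin (.lit (by omega)) (.reg hd2 (by omega))
    (show 2 * d2 < 2 ^ S by omega)) (.lit (by omega)) trivial) (Runs.seq
    (Q := fun s' => s'.reg rSelect = selectCount M d2)
    (Runs.ite (by positivity) (.bin (.reg (v := 2 * d2 - 1) rfl (by omega))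
      (.reg hM (by omega)) trivial) (fun hgt => ?_) fun hle => ?_) ?_)
  · refine Runs.assign (by positivity) (.reg hM (by omega)) ?_
    simp only [Op.eval] at hgt
    change M = min M (2 * d2 - 1)
    omega
  · refine Runs.skip (by positivity) ?_
    simp only [Op.eval] at hle
    change 2 * d2 - 1 = min M (2 * d2 - 1)
    omega
  intro s₁ hF₁ hu₁
  have hM₁ : s₁.reg rDim = M := (hF₁.reg _ rfl).trans hM
  refine Runs.seq (ratioLoop_runs hM₁ ((hF₁.reg _ rfl).trans hmin) hu₁ huM hd hMM) ?_
  rintro s₂ hF₂ ⟨hnumer, hdenom⟩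
  refine Runs.assign (by positivity) (.bin (.bin (.bin
    (.reg hnumer (descFactorial_lt_two_pow le_rfl hd hMM))
    (.reg hdenom (descFactorial_lt_two_pow huM hd hMM)) trivial) (.lit (by omega)) hratio)
    (.bin (.lit (by omega)) (.bin (.reg ((hF₂.reg _ rfl).trans hM₁) (by omega)) (.lit (by omega))
    ?_) hdim) hR) ⟨(hF₂.reg _ rfl).trans hu₁, rfl⟩
  simp only [Op.Fits]
  omega

end Loops

/-! ### The program on an instance -/

section Instance

variable {n m : ℕ} {x : Fin n → Cube m} {a b : Fin n} {dmin d2 : ℕ}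

/-- The bits of the vectors of an instance, extended by `false`. -/
def bits (x : Fin n → Cube m) (i p : ℕ) : Bool :=
  if h : i < n ∧ p < m then x ⟨i, h.1⟩ ⟨p, h.2⟩ else false

theorem bits_coe (x : Fin n → Cube m) (i : Fin n) (p : Fin m) : bits x i p = x i p :=
  dif_pos ⟨i.2, p.2⟩

theorem initState_mem (x : Fin n → Cube m) (dmin d2 : ℕ) (i : Fin n) (p : Fin m) :
    (initState x dmin d2).mem (i * m + p) = (x i p).toNat := by
  have hlt : (i * m + p : ℕ) < n * m := by have := i.2; have := p.2; nlinarith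
  have hdiv : Fin.divNat ⟨i * m + p, hlt⟩ = i := Fin.ext <| by
    rw [Fin.coe_divNat, Fin.val_mk, mul_comm, Nat.mul_add_div (by omega), Nat.div_eq_of_lt p.2,
      add_zero]
  have hmod : Fin.modNat ⟨i * m + p, hlt⟩ = p := Fin.ext <| by
    rw [Fin.coe_modNat, Fin.val_mk, mul_comm, Nat.mul_add_mod, Nat.mod_eq_of_lt p.2]
  simp only [initState, dif_pos hlt, hdiv, hmod]

theorem initState_holdsInput (x : Fin n → Cube m) (hd : dmin ≤ m) (d2 : ℕ) :
    HoldsInput n m dmin (bits x) (initState x dmin d2) :=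
  ⟨rfl, rfl, rfl, hd, fun i hi p hp => (initState_mem x dmin d2 ⟨i, hi⟩ ⟨p, hp⟩).trans
    (congrArg Bool.toNat (bits_coe x ⟨i, hi⟩ ⟨p, hp⟩).symm)⟩

/-- The coordinates below `m` in which the vectors `i` and `j` differ. -/
def diffSet (m : ℕ) (x : ℕ → ℕ → Bool) (i j : ℕ) : Finset ℕ :=
  {p ∈ Finset.range m | x i p ≠ x j p}

theorem card_diffSet (m : ℕ) (x : ℕ → ℕ → Bool) (i j : ℕ) :
    (diffSet m x i j).card = dist m x i j :=
  (Nat.count_eq_card_filter_range _ _).symm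

theorem dist_bits (x : Fin n → Cube m) (i j : Fin n) :
    dist m (bits x) i j = hammingDist (x i) (x j) := by
  rw [← card_diffSet, diffSet, Finset.card_filter, Finset.sum_range, hammingDist,
    Finset.card_filter]
  simp only [bits_coe]

theorem bucket_length_le_of_isGappedInstance (h : IsGappedInstance x a b dmin d2) (r k : ℕ) {i : ℕ}
    (hi : i < n) : (bucket (fun j => keyNum (bits x j) m (selectCount m d2) r k) i
      (keyNum (bits x i) m (selectCount m d2) r k)).length ≤ 2 * d2 + 1 := by
  set L := bucket (fun j => keyNum (bits x j) m (selectCount m d2) r k) i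
    (keyNum (bits x i) m (selectCount m d2) r k) with hL
  have hnodup : L.Nodup := List.nodup_range.filter _
  set I : Finset (Fin n) := {j | (j : ℕ) ∈ L}
  set U : Finset (Fin m) := {q | (q : ℕ) ∈ selection m (selectCount m d2) r}
  have hLI : L.length ≤ I.card := by
    rw [← List.toFinset_card_of_nodup hnodup]
    refine Finset.card_le_card_of_surjOn Fin.val fun j hj => ?_
    have hjL := List.mem_toFinset.1 hj
    exact ⟨⟨j, (mem_bucket.1 hjL).1.trans hi⟩, by simpa [I] using hjL, rfl⟩
  have hU : U.card ≤ 2 * d2 - 1 := calc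
    U.card ≤ (selection m (selectCount m d2) r).card :=
      Finset.card_le_card_of_injOn Fin.val (fun q hq => by simpa [U] using hq)
        Fin.val_injective.injOn
    _ ≤ selectCount m d2 := card_selection_le _ _ _
    _ ≤ 2 * d2 - 1 := min_le_right _ _
  have hd2 : 0 < d2 := h.2.2.1.pos
  refine hLI.trans (h.card_le_of_agree_off (U := U) (by omega) fun i₁ hi₁ i₂ hi₂ q hq => ?_)
  simp only [I, Finset.mem_filter_univ, hL, mem_bucket] at hi₁ hi₂
  have hagree := (keyNum_eq_iff.1 (hi₁.2.trans hi₂.2.symm)).2 q q.2 (by simpa [U] using hq)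
  rwa [bits_coe, bits_coe] at hagree

/-- A bound for the bit lengths of all numbers that occur in the computation. -/
def bitBound (m : ℕ) : ℕ := 5 * (m + 1) ^ 2

theorem repCount_lt (hd : dmin ≤ m) (d2 : ℕ) : repCount m dmin d2 < 2 ^ (m * m + m + 4) := by
  have hratio : m.descFactorial dmin / (selectCount m d2).descFactorial dmin + 1 ≤
      2 ^ (m * m + 1) := Nat.succ_le_of_lt <| (Nat.div_le_self _ _).trans_lt <|
    descFactorial_lt_two_pow le_rfl hd (Nat.lt_succ_self _)
  have hdim : 4 * (m + 1) ≤ 2 ^ (m + 2) := by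
    have : m < 2 ^ m := Nat.lt_two_pow_self
    rw [pow_add]
    omega
  calc repCount m dmin d2 ≤ 2 ^ (m * m + 1) * 2 ^ (m + 2) := Nat.mul_le_mul hratio hdim
    _ = 2 ^ (m * m + m + 3) := by rw [← pow_add]; congr 1; omega
    _ < 2 ^ (m * m + m + 4) := Nat.pow_lt_pow_succ one_lt_two

theorem capacity_of_isGappedInstance (h : IsGappedInstance x a b dmin d2) :
    Capacity n m (repCount m dmin d2) (bitBound m) := by
  have hd := h.2.2.1
  have hd2 := h.d2_le
  have hcard : n + 1 ≤ 2 ^ (m + 2) := by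
    have := h.card_le_two_pow
    have := Nat.one_le_two_pow (n := m)
    rw [pow_add]
    omega
  refine ⟨h.two_lt.le, Nat.mul_pos (Nat.succ_pos _) (by omega), ?_⟩
  calc (repCount m dmin d2 + 1) * 2 ^ m * (n + 1)
      ≤ 2 ^ (m * m + m + 4) * 2 ^ m * 2 ^ (m + 2) := by
        gcongr
        exact repCount_lt (by omega) d2
    _ = 2 ^ (m * m + m + 4 + m + (m + 2)) := by rw [← pow_add, ← pow_add]
    _ ≤ 2 ^ bitBound m := Nat.pow_le_pow_right two_pos (by rw [bitBound]; nlinarith)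

theorem outputs_of_dist_le (h : IsGappedInstance x a b dmin d2) {i j : ℕ} (hi : i < n) (hj : j < n)
    (hij : i ≠ j) (hdist : dist m (bits x) i j ≤ dmin) {s : State} (h0 : s.reg 0 = i)
    (h1 : s.reg 1 = j) : Outputs s a b := by
  lift i to Fin n using hi
  lift j to Fin n using hj
  rw [dist_bits] at hdist
  rcases h.eq_or_eq_of_hammingDist_le (Fin.val_ne_iff.1 hij) hdist with ⟨rfl, rfl⟩ | ⟨rfl, rfl⟩
  exacts [Or.inl ⟨h0, h1⟩, Or.inr ⟨h0, h1⟩]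

theorem collides_of_diffSet_subset (h : IsGappedInstance x a b dmin d2) {u r : ℕ}
    (hsub : diffSet m (bits x) a b ⊆ selection m u r) : Collides n m dmin (bits x) u r := by
  refine ⟨b, b.2, a, h.1, fun q hq hqsel => ?_, ?_⟩
  · by_contra hne
    exact hqsel (hsub (Finset.mem_filter.2 ⟨Finset.mem_range.2 hq, hne⟩))
  · rw [dist_bits, hammingDist_comm, h.2.1]

/-- How often a node of the program is executed at most. -/
def passCount (n m dmin d2 : ℕ) : ℕ :=
  (repCount m dmin d2 + 1) * (m * m + 1 + (n + 1) * ((2 * d2 + 1 + 1) * (m + 1)))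

theorem program_runs (h : IsGappedInstance x a b dmin d2) (dec : Cube m → Cube m) (ω : ℕ → Bool) :
    Runs dec ω (bitBound m) program (initState x dmin d2) (passCount n m dmin d2) fun s' =>
      (∃ ρ < repCount m dmin d2, diffSet m (bits x) a b ⊆
        selection m (selectCount m d2) (coinNum ω (ρ * (m * m)) (m * m))) → Outputs s' a b := by
  have hd : dmin ≤ m := h.2.2.1.le.trans h.d2_le
  have hC := capacity_of_isGappedInstance h
  have hI := initState_holdsInput x hd d2
  have hMM : m * m < bitBound m := by rw [bitBound]; nlinarith
  have hn := h.two_lt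
  have hnS := hC.card_lt
  have huS : selectCount m d2 < 2 ^ bitBound m := (min_le_left _ _).trans_lt hC.dim_lt
  have hR : repCount m dmin d2 < 2 ^ bitBound m := (repCount_lt hd d2).trans_le
    (Nat.pow_le_pow_right two_pos (by rw [bitBound]; nlinarith))
  have hpos : dmin + 1 ≤ passCount n m dmin d2 := by
    calc dmin + 1 ≤ 1 * ((2 * d2 + 1 + 1) * (m + 1)) := by nlinarith
      _ ≤ (n + 1) * ((2 * d2 + 1 + 1) * (m + 1)) := Nat.mul_le_mul_right _ (Nat.succ_pos n)
      _ ≤ m * m + 1 + (n + 1) * ((2 * d2 + 1 + 1) * (m + 1)) := Nat.le_add_left _ _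
      _ ≤ passCount n m dmin d2 := Nat.le_mul_of_pos_left _ (Nat.succ_pos _)
  refine Runs.seq ((setup_runs rfl rfl rfl hd h.d2_le hMM hR).mono hpos fun _ _ h => h) ?_
  rintro s₁ hF₁ ⟨hu₁, hR₁⟩
  have hmem₁ : s₁.mem = (initState x dmin d2).mem := hF₁.mem rfl
  have hcand₁ : Candidates n m dmin (bits x) False s₁ :=
    ⟨(hF₁.reg rLeft rfl).trans_lt (show 0 < n by omega),
      (hF₁.reg rRight rfl).trans_lt (show 0 < n by omega), False.elim⟩
  refine Runs.seq (repLoop_runs hC (hI.of_frame hF₁ rfl rfl rfl rfl) hMM.le hR₁ hu₁ huS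
    (fun r k i hi => bucket_length_le_of_isGappedInstance h r k hi) (hF₁.coins rfl)
    (fun c hc => hmem₁ ▸ dif_neg hc.not_gt) hcand₁) ?_
  intro s₂ _ hcand₂
  have hl := hcand₂.left_lt
  have hr := hcand₂.right_lt
  refine Runs.assign_seq (by omega) (.reg rfl (by omega)) (Runs.assign (by omega)
    (.reg (v := s₂.reg rRight) rfl (by omega)) ?_)
  rintro ⟨ρ, hρ, hsub⟩
  have hclose := hcand₂.close ⟨ρ, hρ, collides_of_diffSet_subset h hsub⟩
  exact outputs_of_dist_le h hl hr hclose.1 hclose.2 rfl rfl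

/-! ### Success probability and running time -/

theorem selectCount_descFactorial_pos (h : IsGappedInstance x a b dmin d2) :
    0 < (selectCount m d2).descFactorial dmin := by
  have hd := h.2.2.1
  have hd2 := h.d2_le
  rw [Nat.descFactorial_pos, selectCount]
  omega

theorem card_le_exp (h : IsGappedInstance x a b dmin d2) : (n : ℝ) ≤ Real.exp (m + 1) := by
  have hn : n ≤ 2 ^ (m + 1) := by
    have := h.card_le_two_pow
    have := Nat.one_le_two_pow (n := m)
    rw [pow_succ]
    omega
  have htwo : (2 : ℝ) ≤ Real.exp 1 := one_add_one_eq_two (R := ℝ) ▸ Real.add_one_le_exp 1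
  calc (n : ℝ) ≤ 2 ^ (m + 1) := by exact_mod_cast hn
    _ ≤ Real.exp 1 ^ (m + 1) := by gcongr
    _ = Real.exp (m + 1) := by rw [← Real.exp_nat_mul]; push_cast; rw [mul_one]

theorem mul_descFactorial_le_repCount_mul (h : IsGappedInstance x a b dmin d2) :
    4 * (m + 1) * m.descFactorial dmin ≤
      repCount m dmin d2 * (selectCount m d2).descFactorial dmin := by
  have hlt := Nat.lt_mul_div_succ (m.descFactorial dmin) (selectCount_descFactorial_pos h)
  calc 4 * (m + 1) * m.descFactorial dmin ≤ 4 * (m + 1) * _ := Nat.mul_le_mul_left _ hlt.le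
    _ = repCount m dmin d2 * (selectCount m d2).descFactorial dmin := by rw [repCount]; ring

theorem one_sub_pow_le_exp_neg_mul {p : ℝ} (hp : p ≤ 1) (R : ℕ) :
    (1 - p) ^ R ≤ Real.exp (-(R * p)) := calc
  (1 - p) ^ R ≤ Real.exp (-p) ^ R :=
    pow_le_pow_left₀ (sub_nonneg.2 hp) (Real.one_sub_le_exp_neg p) R
  _ = Real.exp (-(R * p)) := by rw [← Real.exp_nat_mul, mul_neg]

/-- The random numbers whose selection contains all coordinates in which `a` and `b` differ. -/
noncomputable def goodSeeds (x : Fin n → Cube m) (a b : Fin n) (d2 : ℕ) : Finset ℕ :=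
  {r ∈ Finset.range (2 ^ (m * m)) | diffSet m (bits x) a b ⊆ selection m (selectCount m d2) r}

theorem two_mul_le_repCount_mul_card_goodSeeds (h : IsGappedInstance x a b dmin d2) :
    2 * ((m : ℝ) + 1) ≤ repCount m dmin d2 * ((goodSeeds x a b d2).card / 2 ^ (m * m)) := by
  have hcard : (diffSet m (bits x) a b).card = dmin := by rw [card_diffSet, dist_bits, h.2.1]
  have hfact : m.factorial ≤ 2 ^ (m * m) :=
    m.descFactorial_self ▸ descFactorial_le_two_pow m m
  have hgood : 2 ^ (m * m) * (selectCount m d2).descFactorial dmin ≤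
      2 * m.descFactorial dmin * (goodSeeds x a b d2).card := by
    have hsub : diffSet m (bits x) a b ⊆ Finset.range m := Finset.filter_subset _ _
    rw [← hcard]
    exact mul_descFactorial_le_card_subset_selection (min_le_left m _) hfact hsub
  have hpos : 0 < m.descFactorial dmin :=
    Nat.descFactorial_pos.2 (h.2.2.1.le.trans h.d2_le)
  have hnat : 2 * (m + 1) * 2 ^ (m * m) ≤ repCount m dmin d2 * (goodSeeds x a b d2).card := by
    refine Nat.le_of_mul_le_mul_left (?_ : 2 * m.descFactorial dmin * _ ≤ _) (by positivity)
    calc 2 * m.descFactorial dmin * (2 * (m + 1) * 2 ^ (m * m))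
        = 2 ^ (m * m) * (4 * (m + 1) * m.descFactorial dmin) := by ring
      _ ≤ 2 ^ (m * m) * (repCount m dmin d2 * (selectCount m d2).descFactorial dmin) :=
        Nat.mul_le_mul_left _ (mul_descFactorial_le_repCount_mul h)
      _ = repCount m dmin d2 * (2 ^ (m * m) * (selectCount m d2).descFactorial dmin) := by ring
      _ ≤ repCount m dmin d2 * (2 * m.descFactorial dmin * (goodSeeds x a b d2).card) :=
        Nat.mul_le_mul_left _ hgood
      _ = 2 * m.descFactorial dmin * (repCount m dmin d2 * (goodSeeds x a b d2).card) := by ring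
  rw [mul_div_assoc', le_div_iff₀ (by positivity)]
  exact_mod_cast hnat

theorem le_coinLaw_exists_diffSet_subset (h : IsGappedInstance x a b dmin d2) :
    1 - 1 / (n : ℝ) ^ 2 ≤ coinLaw.real {ω | ∃ ρ < repCount m dmin d2, diffSet m (bits x) a b ⊆
      selection m (selectCount m d2) (coinNum ω (ρ * (m * m)) (m * m))} := by
  have hsub : goodSeeds x a b d2 ⊆ Finset.range (2 ^ (m * m)) := Finset.filter_subset _ _
  set p : ℝ := (goodSeeds x a b d2).card / 2 ^ (m * m) with hp
  have hp1 : p ≤ 1 := by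
    rw [hp, div_le_one (by positivity)]
    exact_mod_cast (Finset.card_le_card hsub).trans_eq (Finset.card_range _)
  have hn : (0 : ℝ) < n := by exact_mod_cast (Nat.zero_lt_two.trans h.two_lt)
  have hfail : (1 - p) ^ repCount m dmin d2 ≤ 1 / (n : ℝ) ^ 2 := by
    calc (1 - p) ^ repCount m dmin d2
        ≤ Real.exp (-(repCount m dmin d2 * p)) := one_sub_pow_le_exp_neg_mul hp1 _
      _ ≤ Real.exp (-(2 * ((m : ℝ) + 1))) :=
        Real.exp_le_exp.2 (neg_le_neg (two_mul_le_repCount_mul_card_goodSeeds h))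
      _ = 1 / Real.exp (m + 1) ^ 2 := by
        rw [Real.exp_neg, ← Real.exp_nat_mul, one_div, Nat.cast_ofNat]
      _ ≤ 1 / (n : ℝ) ^ 2 := by gcongr; exact card_le_exp h
  have hgood (ω : ℕ → Bool) (c : ℕ) : coinNum ω c (m * m) ∈ goodSeeds x a b d2 ↔
      diffSet m (bits x) a b ⊆ selection m (selectCount m d2) (coinNum ω c (m * m)) := by
    rw [goodSeeds, Finset.mem_filter, Finset.mem_range, and_iff_right (coinNum_lt ω c _)]
  have hblock := one_sub_pow_le_coinLaw_exists_block hsub (repCount m dmin d2)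
  simp only [hgood] at hblock
  linarith

/-- A bound for the running time of the program. -/
def totalTime (n m dmin d2 : ℕ) : ℕ :=
  passCount n m dmin d2 * (program.nodes * stepTime (bitBound m))

theorem passCount_le (hd2 : d2 ≤ m) (hn : 0 < n) :
    passCount n m dmin d2 ≤ (repCount m dmin d2 + 1) * (5 * n * (m + 1) ^ 2) := by
  refine Nat.mul_le_mul_left _ ?_
  calc m * m + 1 + (n + 1) * ((2 * d2 + 1 + 1) * (m + 1))
      ≤ n * (m + 1) ^ 2 + 2 * n * (2 * (m + 1) * (m + 1)) := by
        gcongr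
        · nlinarith
        · omega
        · omega
    _ = 5 * n * (m + 1) ^ 2 := by ring

theorem stepTime_bitBound_le (m : ℕ) : stepTime (bitBound m) ≤ 108 * (m + 1) ^ 4 := calc
  stepTime (bitBound m) ≤ 3 * (6 * (m + 1) ^ 2) ^ 2 := by
    have := Nat.one_le_pow 2 (m + 1) m.succ_pos
    rw [stepTime, bitBound]
    gcongr
    linarith
  _ = 108 * (m + 1) ^ 4 := by ring

theorem repCount_add_one_le (h : IsGappedInstance x a b dmin d2) {z : ℝ}
    (hz : (m.descFactorial dmin : ℝ) ≤ 2 * (m + 1) * (selectCount m d2).descFactorial dmin * z) :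
    (repCount m dmin d2 : ℝ) + 1 ≤ 18 * ((m : ℝ) + 1) ^ 2 * z := by
  have hu : (0 : ℝ) < (selectCount m d2).descFactorial dmin := by
    exact_mod_cast selectCount_descFactorial_pos h
  set q : ℝ := (m.descFactorial dmin : ℝ) / (selectCount m d2).descFactorial dmin with hq
  have hq1 : 1 ≤ q := by
    rw [hq, one_le_div hu]
    exact_mod_cast Nat.descFactorial_le dmin (min_le_left m (2 * d2 - 1))
  have hqz : q ≤ 2 * (m + 1) * z := by
    rw [hq, div_le_iff₀ hu]
    linarith
  have hfloor : ((m.descFactorial dmin / (selectCount m d2).descFactorial dmin : ℕ) : ℝ) ≤ q :=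
    Nat.cast_div_le
  rw [repCount]
  push_cast
  calc _ ≤ (q + q) * (4 * ((m : ℝ) + 1)) + q * (m + 1) := by gcongr; nlinarith
    _ = 9 * (m + 1) * q := by ring
    _ ≤ 9 * (m + 1) * (2 * (m + 1) * z) := by gcongr
    _ = 18 * ((m : ℝ) + 1) ^ 2 * z := by ring

theorem one_le_logb_two_sq (hn : 2 ≤ n) : 1 ≤ Real.logb 2 n ^ 2 := by
  refine one_le_pow₀ ((Real.le_logb_iff_rpow_le one_lt_two (by positivity)).2 ?_)
  rw [Real.rpow_one]
  exact_mod_cast hn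

/-- The constant factor of the running time. -/
def timeFactor : ℕ := program.nodes * (108 * 5 * 18 * 2 ^ 8)

theorem totalTime_le_timeBound (h : IsGappedInstance x a b dmin d2) {γ : ℝ}
    (hγ : (m.descFactorial dmin : ℝ) ≤
      2 * (m + 1) * (selectCount m d2).descFactorial dmin * 2 ^ (γ * m)) :
    (totalTime n m dmin d2 : ℝ) ≤ timeBound timeFactor 8 γ n m := by
  have hm : (m : ℝ) + 1 ≤ 2 * m := by
    have : 1 ≤ m := (Nat.zero_le _).trans_lt h.2.2.1 |>.trans_le h.d2_le
    have : (1 : ℝ) ≤ m := by exact_mod_cast this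
    linarith
  have hnat : totalTime n m dmin d2 ≤ (repCount m dmin d2 + 1) * (5 * n * (m + 1) ^ 2) *
      (program.nodes * (108 * (m + 1) ^ 4)) := by
    rw [totalTime]
    gcongr
    exacts [passCount_le h.d2_le (Nat.zero_lt_two.trans h.two_lt), stepTime_bitBound_le m]
  calc (totalTime n m dmin d2 : ℝ)
      ≤ (repCount m dmin d2 + 1) * (5 * n * (m + 1) ^ 2) *
        (program.nodes * (108 * (m + 1) ^ 4)) := by exact_mod_cast hnat
    _ ≤ 18 * (m + 1) ^ 2 * 2 ^ (γ * m) * (5 * n * (m + 1) ^ 2) *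
        (program.nodes * (108 * (m + 1) ^ 4)) := by gcongr; exact repCount_add_one_le h hγ
    _ = program.nodes * (108 * 5 * 18) * (n * 1 * 2 ^ (γ * m) * (m + 1) ^ 8) := by ring
    _ ≤ program.nodes * (108 * 5 * 18) *
        (n * Real.logb 2 n ^ 2 * 2 ^ (γ * m) * (2 * m) ^ 8) := by
        gcongr
        exact one_le_logb_two_sq h.two_lt.le
    _ = timeBound timeFactor 8 γ n m := by
        rw [timeBound]
        unfold timeFactor
        -- Otherwise the number of nodes would be evaluated.
        generalize program.nodes = N
        push_cast
        ring

theorem program_findsPair (h : IsGappedInstance x a b dmin d2) (dec : Cube m → Cube m) {γ : ℝ}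
    (hγ : (m.descFactorial dmin : ℝ) ≤
      2 * (m + 1) * (selectCount m d2).descFactorial dmin * 2 ^ (γ * m)) :
    FindsPair dec program x a b dmin d2 (timeBound timeFactor 8 γ n m) := by
  refine ⟨fun ω => ?_, (le_coinLaw_exists_diffSet_subset h).trans
    (MeasureTheory.measureReal_mono fun ω hω => ?_)⟩ <;>
    obtain ⟨s, t, hexec, htime, hout⟩ := program_runs h dec ω
  · exact ⟨s, t, hexec, (Nat.cast_le.2 htime).trans (totalTime_le_timeBound h hγ)⟩
  · exact ⟨s, t, hexec, hout hω⟩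

/-! ### The exponents -/

theorem descFactorial_le_of_two_mul_le (h : IsGappedInstance x a b dmin d2) (hm : 2 * d2 ≤ m)
    {γ : ℝ} (hγ : H2 ((d2 : ℝ) / m) - midExponent ((dmin : ℝ) / m) ((d2 : ℝ) / m) ≤ γ) :
    (m.descFactorial dmin : ℝ) ≤
      2 * (m + 1) * (selectCount m d2).descFactorial dmin * 2 ^ (γ * m) := by
  have hd := h.2.2.1
  rw [selectCount, min_eq_right (by omega)]
  refine (descFactorial_le_two_rpow_sub_midExponent hd.le (by omega) hm).trans ?_
  gcongr
  norm_num

theorem descFactorial_le_of_lt_two_mul (hm : m < 2 * d2) {γ : ℝ}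
    (hγ : 1 ≤ 2 * ((m : ℝ) + 1) * 2 ^ (γ * m)) :
    (m.descFactorial dmin : ℝ) ≤
      2 * (m + 1) * (selectCount m d2).descFactorial dmin * 2 ^ (γ * m) := by
  rw [selectCount, min_eq_left (by omega)]
  calc (m.descFactorial dmin : ℝ) ≤ m.descFactorial dmin * (2 * ((m : ℝ) + 1) * 2 ^ (γ * m)) :=
        le_mul_of_one_le_right (by positivity) hγ
    _ = _ := by ring

theorem dim_pos (h : IsGappedInstance x a b dmin d2) : (0 : ℝ) < m := by
  exact_mod_cast ((Nat.zero_le _).trans_lt h.2.2.1).trans_le h.d2_le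

theorem dmin_div_le_one (h : IsGappedInstance x a b dmin d2) : (dmin : ℝ) / m ≤ 1 := by
  rw [div_le_one (dim_pos h)]
  exact_mod_cast h.2.2.1.le.trans h.d2_le

theorem d2_div_le_one (h : IsGappedInstance x a b dmin d2) : (d2 : ℝ) / m ≤ 1 := by
  rw [div_le_one (dim_pos h)]
  exact_mod_cast h.d2_le

theorem one_half_le_d2_div (h : IsGappedInstance x a b dmin d2) (hm : m < 2 * d2) :
    1 / 2 ≤ (d2 : ℝ) / m := by
  rw [div_le_div_iff₀ two_pos (dim_pos h), one_mul, mul_comm]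
  exact_mod_cast hm.le

theorem descFactorial_le_zyablov (h : IsGappedInstance x a b dmin d2) :
    (m.descFactorial dmin : ℝ) ≤ 2 * (m + 1) * (selectCount m d2).descFactorial dmin *
      2 ^ ((1 - kappaZ ((d2 : ℝ) / m) - midExponent ((dmin : ℝ) / m) ((d2 : ℝ) / m)) * m) := by
  rcases Nat.lt_or_ge m (2 * d2) with hm | hm
  · refine descFactorial_le_of_lt_two_mul hm ?_
    have hκ := kappaZ_nonpos (one_half_le_d2_div h hm) (d2_div_le_one h)
    have hmid := midExponent_le_one (dmin_div_le_one h) ((d2 : ℝ) / m)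
    refine one_le_mul_of_one_le_of_one_le ?_ (Real.one_le_rpow one_le_two ?_)
    · have := dim_pos h
      linarith
    · exact mul_nonneg (by linarith) (dim_pos h).le
  · have := kappaZ_le_one_sub_H2 (by positivity) (d2_div_le_one h)
    exact descFactorial_le_of_two_mul_le h hm (by linarith)

theorem neg_logb_card_le_of_meetsGV (h : IsGappedInstance x a b dmin d2) (hm : m < 2 * d2)
    {C : Finset (Cube m)} (hGV : MeetsGV C (d2 + 1)) :
    -Real.logb 2 C.card ≤
      (H2 ((d2 : ℝ) / m) - midExponent ((dmin : ℝ) / m) ((d2 : ℝ) / m)) * m := by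
  have hm0 := dim_pos h
  have hanti : H2 (((d2 + 1 : ℕ) : ℝ) / m) ≤ H2 ((d2 : ℝ) / m) := by
    refine H2_le_H2_of_one_half_le (one_half_le_d2_div h hm) (d2_div_le_one h) ?_
    gcongr
    exact Nat.le_succ d2
  have hmid := midExponent_le_one (dmin_div_le_one h) ((d2 : ℝ) / m)
  have hrate := hGV.2
  rw [codeRate, le_div_iff₀ hm0] at hrate
  nlinarith

theorem descFactorial_le_of_meetsGV (h : IsGappedInstance x a b dmin d2) {C : Finset (Cube m)}
    (hC : IsCode C (d2 + 1)) (hGV : MeetsGV C (d2 + 1)) :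
    (m.descFactorial dmin : ℝ) ≤ 2 * (m + 1) * (selectCount m d2).descFactorial dmin *
      2 ^ ((H2 ((d2 : ℝ) / m) - midExponent ((dmin : ℝ) / m) ((d2 : ℝ) / m)) * m) := by
  rcases Nat.lt_or_ge m (2 * d2) with hm | hm
  · refine descFactorial_le_of_lt_two_mul hm ?_
    have hcard : (C.card : ℝ) ≤ 2 * (m + 1) := by
      have hPlotkin := hC.card_le (by omega)
      have hd2 := h.d2_le
      exact_mod_cast (show C.card ≤ 2 * (m + 1) by omega)
    have hpos : (0 : ℝ) < C.card := by exact_mod_cast hGV.1.card_pos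
    calc (1 : ℝ) = C.card * 2 ^ (-Real.logb 2 C.card) := by
          rw [Real.rpow_neg two_pos.le, Real.rpow_logb two_pos (by norm_num) hpos,
            mul_inv_cancel₀ hpos.ne']
      _ ≤ _ := by
          gcongr
          exacts [one_le_two, neg_logb_card_le_of_meetsGV h hm hGV]
  · exact descFactorial_le_of_two_mul_le h hm le_rfl

end Instance

end RAM.ClosestPair

theorem theorem3p2_general :
    ∃ P : RAM.Cmd, P.OracleFree ∧ ∃ A k : ℕ,
      ∀ (n m : ℕ) (x : Fin n → Cube m) (a b : Fin n) (dmin d2 : ℕ),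
        IsGappedInstance x a b dmin d2 → ∀ dec : Cube m → Cube m,
        RAM.FindsPair dec P x a b dmin d2
          (timeBound A k
            (1 - kappaZ ((d2 : ℝ) / m) - midExponent ((dmin : ℝ) / m) ((d2 : ℝ) / m)) n m) ∧
        ∀ C : Finset (Cube m), IsCode C (d2 + 1) → MeetsGV C (d2 + 1) →
        RAM.FindsPair dec P x a b dmin d2
          (timeBound A k
            (H2 ((d2 : ℝ) / m) - midExponent ((dmin : ℝ) / m) ((d2 : ℝ) / m)) n m) :=
  ⟨RAM.ClosestPair.program, RAM.ClosestPair.program_oracleFree, RAM.ClosestPair.timeFactor, 8,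
    fun _ _ _ _ _ _ _ h dec =>
      ⟨RAM.ClosestPair.program_findsPair h dec (RAM.ClosestPair.descFactorial_le_zyablov h),
        fun _ hC hGV => RAM.ClosestPair.program_findsPair h dec
          (RAM.ClosestPair.descFactorial_le_of_meetsGV h hC hGV)⟩⟩

theorem theorem3p2 :
    (∃ P : RAM.Cmd, P.OracleFree ∧ ∃ A k : ℕ,
      ∀ (n m : ℕ) (x : Fin n → Cube m) (a b : Fin n) (dmin d2 : ℕ),
        IsGappedInstance x a b dmin d2 →
        RAM.FindsPair (id : Cube m → Cube m) P x a b dmin d2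
          (timeBound A k
            (1 - kappaZ ((d2 : ℝ) / (m : ℝ)) -
              midExponent ((dmin : ℝ) / (m : ℝ)) ((d2 : ℝ) / (m : ℝ))) n m)) ∧
    (∃ P : RAM.Cmd, ∃ A k : ℕ,
      ∀ (n m : ℕ) (x : Fin n → Cube m) (a b : Fin n) (dmin d2 : ℕ),
        IsGappedInstance x a b dmin d2 →
        ∀ C : Finset (Cube m), IsCode C (d2 + 1) → MeetsGV C (d2 + 1) →
        ∀ dec : Cube m → Cube m, IsUniqueDecoder C (d2 + 1) dec →
        RAM.FindsPair dec P x a b dmin d2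
          (timeBound A k
            (H2 ((d2 : ℝ) / (m : ℝ)) -
              midExponent ((dmin : ℝ) / (m : ℝ)) ((d2 : ℝ) / (m : ℝ))) n m)) := by
  obtain ⟨P, hP, A, k, h⟩ := theorem3p2_general
  exact ⟨⟨P, hP, A, k, fun n m x a b dmin d2 hx => (h n m x a b dmin d2 hx id).1⟩,
    P, A, k, fun n m x a b dmin d2 hx C hC hGV dec _ => (h n m x a b dmin d2 hx dec).2 C hC hGV⟩
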